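/- Let $1<\alpha<2$, let $\kappa_1,\kappa_2>0$, and let $L^1,L^2$ be independent one-dimensional symmetric $\alpha$-stable processes (Lévy processes with $\mathbb{E}\,e^{ihL^i_t}=e^{-t\kappa_i|h|^{\alpha}}$) on a probability space. For $\varepsilon>0$ and $x\in\mathbb{R}$ consider $$dX^{\varepsilon}_t=Y^{\varepsilon}_t\,dt+dL^1_t,\quad X^\varepsilon_0=x,\qquad dY^{\varepsilon}_t=-\frac1\varepsilon Y^{\varepsilon}_t\,dt+\frac{1}{\varepsilon^{1/\alpha}}\,dL^2_t,\quad Y^\varepsilon_0=0 .$$ This system, and the frozen equation $dY_t=-Y_t\,dt+dL^2_t$, $Y_0=y$, for every $y\in\mathbb{R}$, have pathwise unique càdlàg solutions. The transition semigroup of the frozen equation has a unique invariant probability measure $\mu$; it is integrable with $\int y\,\mu(dy)=0$. Hence the averaged equation $d\bar X_t=\bar b(\bar X_t)\,dt+dL^1_t$, $\bar X_0=x$, with $\bar b(x)=\int y\,\mu(dy)$, has the unique solution $\bar X_t=x+L^1_t$. For $0<p<\alpha$ put $$C_{\alpha,p}=\frac{2^{p}\,\Gamma\!\left(\frac{1+p}{2}\right)\Gamma\!\left(1-\frac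 p\alpha\right)}{\sqrt{\pi}\;\Gamma\!\left(1-\frac p2\right)}>0 .$$ Then, for all $0<p<\alpha$: 1. for all $\varepsilon>0$ and $t\ge0$, $|X^\varepsilon_t-\bar X_t|^p$ is integrable and $$\mathbb{E}\,|X^{\varepsilon}_t-\bar X_t|^p=C_{\alpha,p}\,\kappa_2^{p/\alpha}\left[\int_0^t\bigl(1-e^{-r/\varepsilon}\bigr)^{\alpha}dr\right]^{p/\alpha}\varepsilon^{p(1-1/\alpha)} ;$$ 2. for every $t>0$, $\ \lim_{\varepsilon\to0^+}\varepsilon^{-p(1-1/\alpha)}\,\mathbb{E}\,|X^{\varepsilon}_t-\bar X_t|^p=C_{\alpha,p}\,\kappa_2^{p/\alpha}\,t^{p/\alpha}$; 3. the strong order $1-1/\alpha$ cannot be improved: for every $q>1-1/\alpha$ and every $T>0$ there is no constant $C$ such that $\mathbb{E}\,|X^{\varepsilon}_T-\bar X_T|^p\le C\varepsilon^{pq}$ for all sufficiently small $\varepsilon>0$, and none such that $\mathbb{E}\,\sup_{t\in[0,T]}|X^{\varepsilon}_t-\bar X_t|^p\le C\varepsilon^{pq}$ for all sufficiently small $\varepsilon>0$.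 -/

import Mathlib

open MeasureTheory ProbabilityTheory Filter Set
open scoped NNReal ENNReal Topology

/-- A path on `[0, ∞)` that is right-continuous and has (finite) left limits. -/
def IsCadlag (z : ℝ≥0 → ℝ) : Prop :=
  ∀ t : ℝ≥0, ContinuousWithinAt z (Ici t) t ∧ ∃ l : ℝ, Tendsto z (𝓝[<] t) (𝓝 l)

/-- `L` is a one-dimensional symmetric `α`-stable (Lévy) process with characteristic exponent
`ψ(h) = κ |h| ^ α`: it starts at `0`, has independent increments, its increments over `[s, t]` have
characteristic function `exp (-(t - s) κ |h| ^ α)` (so they are stationary), and almost all of its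
paths are càdlàg. -/
structure IsSymmetricStableProcess {Ω : Type*} [MeasurableSpace Ω] (α κ : ℝ)
    (L : ℝ≥0 → Ω → ℝ) (P : Measure Ω) : Prop where
  aemeasurable : ∀ t, AEMeasurable (L t) P
  start_zero : ∀ᵐ ω ∂P, L 0 ω = 0
  indep_increments : HasIndepIncrements L P
  charFun_increment : ∀ s t : ℝ≥0, s ≤ t → ∀ h : ℝ,
    charFun (P.map (fun ω => L t ω - L s ω)) h
      = (Real.exp (-(((t : ℝ) - (s : ℝ)) * (κ * |h| ^ α))) : ℂ)
  cadlag : ∀ᵐ ω ∂P, IsCadlag (fun t => L t ω)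

/-- The path `z` satisfies `z t = z₀ + ∫₀ᵗ g s ds + l t` for all `t ≥ 0`
(the time integral being a genuine Lebesgue integral). -/
def SolvesIntegralEq (g l z : ℝ≥0 → ℝ) (z₀ : ℝ) : Prop :=
  ∀ t : ℝ≥0, IntervalIntegrable (fun s : ℝ => g s.toNNReal) volume 0 t ∧
    z t = z₀ + (∫ s in (0 : ℝ)..t, g s.toNNReal) + l t

/-- `Z` is a (càdlàg) solution of `dZ = g(Z) dt + dL`, `Z₀ = z₀`. -/
structure IsSDESolution {Ω : Type*} [MeasurableSpace Ω] (g : ℝ → ℝ) (L : ℝ≥0 → Ω → ℝ) (z₀ : ℝ)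
    (Z : ℝ≥0 → Ω → ℝ) (P : Measure Ω) : Prop where
  aemeasurable : ∀ t, AEMeasurable (Z t) P
  cadlag : ∀ᵐ ω ∂P, IsCadlag (fun t => Z t ω)
  eq : ∀ᵐ ω ∂P, SolvesIntegralEq (fun s => g (Z s ω)) (fun t => L t ω) (fun t => Z t ω) z₀

/-- `(X, Y)` is a (càdlàg) solution of the slow-fast system
`dX = b(X, Y) dt + dL₁`, `dY = ε⁻¹ f(X, Y) dt + ε ^ (-1/α) dL₂`, `X₀ = x`, `Y₀ = y`. -/
structure IsSlowFastSolution {Ω : Type*} [MeasurableSpace Ω] (b f : ℝ → ℝ → ℝ) (α ε : ℝ)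
    (L₁ L₂ : ℝ≥0 → Ω → ℝ) (x y : ℝ) (X Y : ℝ≥0 → Ω → ℝ) (P : Measure Ω) : Prop where
  aemeasurable_slow : ∀ t, AEMeasurable (X t) P
  aemeasurable_fast : ∀ t, AEMeasurable (Y t) P
  cadlag_slow : ∀ᵐ ω ∂P, IsCadlag (fun t => X t ω)
  cadlag_fast : ∀ᵐ ω ∂P, IsCadlag (fun t => Y t ω)
  slow_eq : ∀ᵐ ω ∂P, SolvesIntegralEq (fun s => b (X s ω) (Y s ω)) (fun t => L₁ t ω)
    (fun t => X t ω) x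
  fast_eq : ∀ᵐ ω ∂P, SolvesIntegralEq (fun s => (1 / ε) * f (X s ω) (Y s ω))
    (fun t => (1 / ε ^ (1 / α)) * L₂ t ω) (fun t => Y t ω) y

/-- `Y x y` solves the frozen equation `dY = f(x, Y) dt + dL₂`, `Y₀ = y`, for all `x`, `y`. -/
def IsFrozenFamily {Ω : Type*} [MeasurableSpace Ω] (f : ℝ → ℝ → ℝ) (L₂ : ℝ≥0 → Ω → ℝ)
    (Y : ℝ → ℝ → ℝ≥0 → Ω → ℝ) (P : Measure Ω) : Prop :=
  ∀ x y, IsSDESolution (f x) L₂ y (Y x y) P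

/-- The transition operators `P_t φ (y) = E φ(Z_t^y)` of a family `Z^y`, where `Z^y` starts
at `y`. -/
noncomputable def transitionOp {Ω : Type*} [MeasurableSpace Ω] (Z : ℝ → ℝ≥0 → Ω → ℝ)
    (P : Measure Ω) (t : ℝ≥0) (φ : ℝ → ℝ) (y : ℝ) : ℝ :=
  ∫ ω, φ (Z y t ω) ∂P

/-- `μ` is an invariant probability measure of the transition operators of `Z`. -/
def IsInvariantLaw {Ω : Type*} [MeasurableSpace Ω] (Z : ℝ → ℝ≥0 → Ω → ℝ)
    (P : Measure Ω) (μ : Measure ℝ) : Prop :=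
  IsProbabilityMeasure μ ∧ ∀ (t : ℝ≥0) (φ : ℝ → ℝ), Measurable φ → (∃ C, ∀ y, |φ y| ≤ C) →
    ∫ y, transitionOp Z P t φ y ∂μ = ∫ y, φ y ∂μ

/-- The averaged drift `x ↦ ∫ b(x, y) μˣ(dy)`. -/
noncomputable def averagedDrift (b : ℝ → ℝ → ℝ) (μ : ℝ → Measure ℝ) (x : ℝ) : ℝ :=
  ∫ y, b x y ∂(μ x)

/-- The slow drift `b(x, y) = y` of the linear example. -/
def slowDrift (_x y : ℝ) : ℝ := y

/-- The fast drift `f(x, y) = -y` of the linear example. -/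
def fastDrift (_x y : ℝ) : ℝ := -y

/-- The `p`-th absolute moment `2 ^ p Γ((1+p)/2) Γ(1-p/α) / (√π Γ(1-p/2))` of the law with
characteristic function `exp (-|h| ^ α)`, for `0 < p < α < 2`. -/
noncomputable def stableMoment (α p : ℝ) : ℝ :=
  2 ^ p * Real.Gamma ((1 + p) / 2) * Real.Gamma (1 - p / α)
    / (Real.sqrt Real.pi * Real.Gamma (1 - p / 2))

/-! ### Càdlàg paths -/

namespace IsCadlag

variable {z w : ℝ≥0 → ℝ}

/-! Everything is linear, so the error can be computed exactly and no averaging estimate is needed.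
For a fixed càdlàg path the Ornstein–Uhlenbeck equation is solved by variation of constants after
integration by parts: `ouPath` contains only Lebesgue integrals of the path, so no stochastic
integral appears. The time integral of `l - r * expConv r l` is `expConv r l` itself
(`integral_sub_expConv`). Applied to the fast component, this gives X - (x + L₁) = ∫₀ᵗ ε^(-1/α)
exp(-(t-s)/ε) L₂(s) ds almost surely (`slow_eq_expConv`). Since the averaged drift vanishes, this is
the whole error.

The law of such an integral comes from `charFun_integral`: summation by parts turns Riemann sums of
the path into weighted sums of independent increments, and characteristic functions pass to the
limit. The error is symmetric stable with scale constant κ₂ ε^(α-1) ∫₀ᵗ (1 - exp(-r/ε))^α dr. Its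
p-th moment follows from `stable_moment`, which writes |x|^p as a multiple of ∫₀^∞ (1 - cos(hx))
h^(-1-p) dh; the normalising constant is found by testing the formula on the standard Gaussian.

The asymptotics follow by dominated convergence, since the last integral tends to t. The limit is
positive, which rules out any larger order; the supremum over [0, T] dominates the value at T.

For the frozen equation, `ouPath` is affine in the starting point, so the semigroup contracts a law
by exp(-t) and convolves it with the noise law. Characteristic functions then identify the only
invariant law as stable with exponent (κ₂/α)|h|^α, which is symmetric, and integrable because α > 1.
-/

lemma of_continuous (hz : Continuous z) : IsCadlag z := fun t =>
  ⟨hz.continuousWithinAt, z t, hz.continuousAt.tendsto.mono_left nhdsWithin_le_nhds⟩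

lemma add (hz : IsCadlag z) (hw : IsCadlag w) : IsCadlag (fun t => z t + w t) := fun t =>
  ⟨(hz t).1.add (hw t).1, let ⟨l, hl⟩ := (hz t).2; let ⟨m, hm⟩ := (hw t).2; ⟨l + m, hl.add hm⟩⟩

lemma mul (hz : IsCadlag z) (hw : IsCadlag w) : IsCadlag (fun t => z t * w t) := fun t =>
  ⟨(hz t).1.mul (hw t).1, let ⟨l, hl⟩ := (hz t).2; let ⟨m, hm⟩ := (hw t).2; ⟨l * m, hl.mul hm⟩⟩

lemma const_mul (c : ℝ) (hz : IsCadlag z) : IsCadlag (fun t => c * z t) :=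
  (of_continuous continuous_const).mul hz

lemma sub (hz : IsCadlag z) (hw : IsCadlag w) : IsCadlag (fun t => z t - w t) := by
  simpa [sub_eq_add_neg] using hz.add (hw.const_mul (-1))

/-- One-sided limits bound the path near each point, and compactness of [0, T] makes the bound
uniform. -/
lemma exists_bound (hz : IsCadlag z) (T : ℝ≥0) : ∃ M : ℝ, ∀ s ≤ T, |z s| ≤ M := by
  have key : ∃ M : ℝ, ∀ s ∈ Icc 0 T, |z s| ≤ M := by
    refine isCompact_Icc.induction_on (p := fun S => ∃ M : ℝ, ∀ s ∈ S, |z s| ≤ M)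
      ⟨0, by simp⟩ ?_ ?_ ?_
    · rintro S S' h ⟨M, hM⟩
      exact ⟨M, fun s hs => hM s (h hs)⟩
    · rintro S S' ⟨M, hM⟩ ⟨M', hM'⟩
      refine ⟨max M M', ?_⟩
      rintro s (hs | hs)
      · exact (hM s hs).trans (le_max_left _ _)
      · exact (hM' s hs).trans (le_max_right _ _)
    · intro s _
      obtain ⟨hr, l, hl⟩ := hz s
      have h₁ : ∀ᶠ u in 𝓝[≥] s, |z u| < |z s| + 1 :=
        hr.abs.tendsto.eventually_lt_const (by simp)
      have h₂ : ∀ᶠ u in 𝓝[<] s, |z u| < |l| + 1 := hl.abs.eventually_lt_const (by simp)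
      have h : ∀ᶠ u in 𝓝 s, |z u| ≤ max (|z s| + 1) (|l| + 1) := by
        rw [← nhdsLT_sup_nhdsGE, eventually_sup]
        exact ⟨h₂.mono fun u hu => hu.le.trans (le_max_right _ _),
          h₁.mono fun u hu => hu.le.trans (le_max_left _ _)⟩
      exact ⟨_, mem_nhdsWithin_of_mem_nhds h, _, fun u hu => hu⟩
  obtain ⟨M, hM⟩ := key
  exact ⟨M, fun s hs => hM s ⟨zero_le, hs⟩⟩

end IsCadlag

/-- Rounding a point up to the grid `δ ℕ` tends to the point itself, from the right, as the mesh
tends to zero. -/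
lemma tendsto_ceil_mul_nhdsGE {δ : ℕ → ℝ} (hδ : ∀ n, 0 < δ n) (hδ₀ : Tendsto δ atTop (𝓝 0))
    {s : ℝ} (hs : 0 ≤ s) :
    Tendsto (fun n => (⌈s / δ n⌉₊ : ℝ) * δ n) atTop (𝓝[≥] s) := by
  have hle (n : ℕ) : s ≤ (⌈s / δ n⌉₊ : ℝ) * δ n := by
    rw [← div_le_iff₀ (hδ n)]; exact Nat.le_ceil _
  refine tendsto_nhdsWithin_iff.2 ⟨?_, Eventually.of_forall hle⟩
  refine tendsto_of_tendsto_of_tendsto_of_le_of_le (g := fun _ => s) (h := fun n => s + δ n)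
    tendsto_const_nhds (by simpa using hδ₀.const_add s) hle fun n => ?_
  have := (Nat.ceil_lt_add_one (div_nonneg hs (hδ n).le)).le
  calc (⌈s / δ n⌉₊ : ℝ) * δ n ≤ (s / δ n + 1) * δ n := by gcongr; exact (hδ n).le
    _ = s + δ n := by have := (hδ n).ne'; field_simp

lemma Real.tendsto_toNNReal_nhdsGE {s : ℝ} :
    Tendsto Real.toNNReal (𝓝[≥] s) (𝓝[≥] s.toNNReal) :=
  tendsto_nhdsWithin_iff.2 ⟨(continuous_real_toNNReal.tendsto s).mono_left nhdsWithin_le_nhds,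
    eventually_mem_nhdsWithin.mono fun _ h => Real.toNNReal_le_toNNReal h⟩

namespace IsCadlag

variable {z : ℝ≥0 → ℝ}

/-- Right-continuity makes the path the pointwise limit of its values at times rounded up to a grid,
and each such step function factors through ℕ. -/
lemma measurable (hz : IsCadlag z) : Measurable z := by
  have hδ (n : ℕ) : (0 : ℝ) < 1 / ((n : ℝ) + 1) := by positivity
  refine measurable_of_tendsto_metrizable
    (f := fun n (s : ℝ≥0) => z ((⌈(s : ℝ) / (1 / ((n : ℝ) + 1))⌉₊ : ℝ) * (1 / ((n : ℝ) + 1))).toNNReal)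
    (fun n => ?_) (tendsto_pi_nhds.2 fun s => ?_)
  · have h : Measurable fun m : ℕ => z ((m : ℝ) * (1 / ((n : ℝ) + 1))).toNNReal :=
      measurable_from_top
    exact h.comp (Nat.measurable_ceil.comp (by fun_prop))
  · have h := Real.tendsto_toNNReal_nhdsGE.comp
      (tendsto_ceil_mul_nhdsGE hδ tendsto_one_div_add_atTop_nhds_zero_nat s.coe_nonneg)
    rw [Real.toNNReal_coe] at h
    exact (hz s).1.tendsto.comp h

lemma measurable_toNNReal (hz : IsCadlag z) : Measurable fun s : ℝ => z s.toNNReal :=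
  hz.measurable.comp measurable_real_toNNReal

lemma intervalIntegrable (hz : IsCadlag z) (a b : ℝ) :
    IntervalIntegrable (fun s : ℝ => z s.toNNReal) volume a b := by
  obtain ⟨M, hM⟩ := hz.exists_bound (max a b).toNNReal
  refine (intervalIntegrable_const (c := M)).mono_fun'
    hz.measurable_toNNReal.aestronglyMeasurable ?_
  refine (ae_restrict_mem measurableSet_uIoc).mono fun s hs => ?_
  exact hM _ (Real.toNNReal_le_toNNReal hs.2)

/-- Only a right derivative is available at a jump. This suffices, because the fundamental theorem
of calculus and the constancy criterion used below need only continuity and right derivatives. -/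
lemma hasDerivWithinAt_integral (hz : IsCadlag z) (t : ℝ) :
    HasDerivWithinAt (fun u => ∫ s in (0 : ℝ)..u, z s.toNNReal) (z t.toNNReal) (Ici t) t := by
  refine intervalIntegral.integral_hasDerivWithinAt_right (hz.intervalIntegrable 0 t)
    (t := Ioi t) hz.measurable_toNNReal.stronglyMeasurable.stronglyMeasurableAtFilter ?_
  exact (((hz _).1.tendsto.comp Real.tendsto_toNNReal_nhdsGE).mono_left
    (nhdsWithin_mono _ Ioi_subset_Ici_self))

lemma continuous_integral (hz : IsCadlag z) :
    Continuous fun u => ∫ s in (0 : ℝ)..u, z s.toNNReal :=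
  intervalIntegral.continuous_primitive hz.intervalIntegrable 0

end IsCadlag

/-! ### Linear integral equations driven by a càdlàg path -/

/-- The convolution `∫₀ᵗ exp (-r (t - s)) l s ds`. -/
noncomputable def expConv (r : ℝ) (l : ℝ≥0 → ℝ) (t : ℝ) : ℝ :=
  ∫ s in (0 : ℝ)..t, Real.exp (-(r * (t - s))) * l s.toNNReal

/-- The solution `y exp (-r t) + l t - r ∫₀ᵗ exp (-r (t - s)) l s ds` of the Ornstein–Uhlenbeck
equation `dZ = -r Z dt + dl`, `Z₀ = y`. -/
noncomputable def ouPath (r y : ℝ) (l : ℝ≥0 → ℝ) (t : ℝ≥0) : ℝ :=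
  y * Real.exp (-(r * t)) + l t - r * expConv r l t

/-- Pulling the dependence on t out of the integrand leaves a product of a smooth factor and a
primitive of a càdlàg path, which can be differentiated from the right. -/
lemma expConv_eq (r : ℝ) (l : ℝ≥0 → ℝ) {t : ℝ} (ht : 0 ≤ t) :
    expConv r l t = Real.exp (-(r * t)) *
      ∫ s in (0 : ℝ)..t, Real.exp (r * s.toNNReal) * l s.toNNReal := by
  rw [expConv, ← intervalIntegral.integral_const_mul]
  refine intervalIntegral.integral_congr fun s hs => ?_
  rw [uIcc_of_le ht] at hs
  simp only [Real.coe_toNNReal s hs.1, ← mul_assoc, ← Real.exp_add]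
  ring_nf

section

variable {l : ℝ≥0 → ℝ}

lemma IsCadlag.exp_mul (hl : IsCadlag l) (r : ℝ) :
    IsCadlag fun s => Real.exp (r * s) * l s :=
  (IsCadlag.of_continuous (by fun_prop)).mul hl

lemma IsCadlag.expConv (hl : IsCadlag l) (r : ℝ) : IsCadlag fun t => expConv r l t := by
  refine IsCadlag.of_continuous ?_
  have h : Continuous fun t : ℝ≥0 => Real.exp (-(r * t)) *
      ∫ s in (0 : ℝ)..t, Real.exp (r * s.toNNReal) * l s.toNNReal :=
    (by fun_prop : Continuous fun t : ℝ≥0 => Real.exp (-(r * t))).mul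
      ((hl.exp_mul r).continuous_integral.comp NNReal.continuous_coe)
  exact h.congr fun t => (expConv_eq r l t.coe_nonneg).symm

lemma IsCadlag.ouPath (hl : IsCadlag l) (r y : ℝ) : IsCadlag (ouPath r y l) :=
  ((IsCadlag.of_continuous (by fun_prop)).add hl).sub ((hl.expConv r).const_mul r)

/-- The convolution vanishes at 0 and has right derivative l - r · (convolution). This identity both
verifies the fast equation and integrates its solution in the slow one. -/
lemma integral_sub_expConv (hl : IsCadlag l) (r : ℝ) (t : ℝ≥0) :
    ∫ s in (0 : ℝ)..t, (l s.toNNReal - r * expConv r l s.toNNReal) = expConv r l t := by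
  have hd := (hl.sub ((hl.expConv r).const_mul r))
  set F : ℝ → ℝ := fun u => Real.exp (-(r * u)) *
      ∫ s in (0 : ℝ)..u, Real.exp (r * s.toNNReal) * l s.toNNReal with hF
  have hc : Continuous F := (by fun_prop : Continuous fun u : ℝ => Real.exp (-(r * u))).mul
      (hl.exp_mul r).continuous_integral
  rw [intervalIntegral.integral_eq_sub_of_hasDeriv_right (f := F) hc.continuousOn ?_
    (hd.intervalIntegrable 0 t)]
  · rw [expConv_eq r l t.coe_nonneg]; simp [hF]
  · intro u hu
    rw [min_eq_left t.coe_nonneg] at hu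
    have h₁ : HasDerivWithinAt (fun u : ℝ => Real.exp (-(r * u))) (Real.exp (-(r * u)) * -r)
        (Ici u) u := by
      simpa using (((hasDerivAt_id u).const_mul r).neg.exp).hasDerivWithinAt
    have h := (h₁.mul ((hl.exp_mul r).hasDerivWithinAt_integral u)).mono Ioi_subset_Ici_self
    refine h.congr_deriv ?_
    rw [Real.coe_toNNReal u hu.1.le, expConv_eq r l hu.1.le, ← mul_assoc (Real.exp _) (Real.exp _),
      ← Real.exp_add]
    simp only [neg_add_cancel, Real.exp_zero]
    ring

lemma ouPath_solves (hl : IsCadlag l) (r y : ℝ) :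
    SolvesIntegralEq (fun s => r * -ouPath r y l s) l (ouPath r y l) y := by
  intro t
  refine ⟨by simpa using ((hl.ouPath r y).const_mul (-1)).const_mul r |>.intervalIntegrable 0 t, ?_⟩
  have hd := (hl.sub ((hl.expConv r).const_mul r)).intervalIntegrable 0 t
  have h : ∫ s in (0 : ℝ)..t, r * -ouPath r y l s.toNNReal
      = ∫ s in (0 : ℝ)..t, (y * (Real.exp (-(r * s)) * -r)
          - r * (l s.toNNReal - r * expConv r l s.toNNReal)) := by
    refine intervalIntegral.integral_congr fun s hs => ?_
    rw [uIcc_of_le t.coe_nonneg] at hs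
    simp only [ouPath, Real.coe_toNNReal s hs.1]
    ring
  have he : ∫ s in (0 : ℝ)..t, Real.exp (-(r * s)) * -r = Real.exp (-(r * t)) - 1 := by
    rw [intervalIntegral.integral_eq_sub_of_hasDerivAt (f := fun s => Real.exp (-(r * s)))]
    · simp
    · intro s _
      simpa using ((hasDerivAt_id s).const_mul r).neg.exp
    · exact (by fun_prop : Continuous fun s : ℝ => Real.exp (-(r * s)) * -r).intervalIntegrable _ _
  rw [h, intervalIntegral.integral_sub
    ((by fun_prop : Continuous fun s : ℝ => y * (Real.exp (-(r * s)) * -r)).intervalIntegrable _ _)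
    (hd.const_mul r), intervalIntegral.integral_const_mul, intervalIntegral.integral_const_mul,
    integral_sub_expConv hl, he, ouPath]
  ring

/-- The Ornstein–Uhlenbeck equation driven by a fixed path has at most one càdlàg solution. -/
lemma SolvesIntegralEq.unique {r y : ℝ} {z w : ℝ≥0 → ℝ} (hz : IsCadlag z) (hw : IsCadlag w)
    (hz' : SolvesIntegralEq (fun s => r * -z s) l z y)
    (hw' : SolvesIntegralEq (fun s => r * -w s) l w y) (t : ℝ≥0) : z t = w t := by
  have hD := hz.sub hw
  have hDeq (u : ℝ≥0) : z u - w u = -r * ∫ s in (0 : ℝ)..u, (z s.toNNReal - w s.toNNReal) := by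
    rw [← intervalIntegral.integral_const_mul]
    have h : ∫ s in (0 : ℝ)..u, -r * (z s.toNNReal - w s.toNNReal)
        = (∫ s in (0 : ℝ)..u, r * -z s.toNNReal) - ∫ s in (0 : ℝ)..u, r * -w s.toNNReal := by
      rw [← intervalIntegral.integral_sub (hz' u).1 (hw' u).1]
      exact intervalIntegral.integral_congr fun s _ => by ring
    rw [h, (hz' u).2, (hw' u).2]
    ring
  set F : ℝ → ℝ := fun u => ∫ s in (0 : ℝ)..u, (z s.toNNReal - w s.toNNReal) with hF
  -- Integrating factor: F has right derivative z - w = -rF, so exp(ru) F(u) is constant, and F(0) =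
  -- 0.
  have hF₀ : F t = 0 := by
    have h := constant_of_has_deriv_right_zero (f := fun u => Real.exp (r * u) * F u)
      (a := 0) (b := t)
      ((by fun_prop : Continuous fun u : ℝ => Real.exp (r * u)).mul
        hD.continuous_integral).continuousOn ?_ t ⟨t.coe_nonneg, le_rfl⟩
    · simpa [hF] using h
    · intro u hu
      have h₁ : HasDerivWithinAt (fun u : ℝ => Real.exp (r * u)) (Real.exp (r * u) * r)
          (Ici u) u := by
        simpa using (((hasDerivAt_id u).const_mul r).exp).hasDerivWithinAt
      refine (h₁.mul (hD.hasDerivWithinAt_integral u)).congr_deriv ?_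
      have := hDeq u.toNNReal
      rw [Real.coe_toNNReal u hu.1] at this
      rw [this]
      ring
  have := hDeq t
  rw [show (∫ s in (0 : ℝ)..t, (z s.toNNReal - w s.toNNReal)) = 0 from hF₀] at this
  linarith

end

/-! ### Integrals of a symmetric stable process -/

/-- Riemann sums with right endpoints, for a càdlàg integrand and a continuous weight. -/
lemma IsCadlag.tendsto_riemannSum {z : ℝ≥0 → ℝ} (hz : IsCadlag z) {k : ℝ → ℝ}
    (hk : Continuous k) (t : ℝ≥0) :
    Tendsto (fun n : ℕ => ∑ i ∈ Finset.range (n + 1),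
      (∫ s in ((i : ℝ) * (t / ((n : ℝ) + 1)))..((i + 1 : ℕ) * (t / ((n : ℝ) + 1))), k s)
        * z ((i + 1 : ℕ) * (t / ((n : ℝ) + 1))).toNNReal) atTop
      (𝓝 (∫ s in (0 : ℝ)..t, k s * z s.toNNReal)) := by
  rcases eq_or_ne t 0 with rfl | ht
  · simp
  have ht' : (0 : ℝ) < t := by positivity
  set δ : ℕ → ℝ := fun n => t / ((n : ℝ) + 1) with hδdef
  have hδ (n : ℕ) : 0 < δ n := by positivity
  have hδ₀ : Tendsto δ atTop (𝓝 0) := by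
    simpa [hδdef, div_eq_mul_one_div (t : ℝ)] using
      tendsto_one_div_add_atTop_nhds_zero_nat.const_mul (t : ℝ)
  have hδn (n : ℕ) : ((n + 1 : ℕ) : ℝ) * δ n = t := by
    simp only [hδdef]; push_cast; field_simp
  obtain ⟨M, hM⟩ := hz.exists_bound t
  -- Rounding only the argument of z up to the grid makes the n-th sum exactly the integral of `g
  -- n`, so dominated convergence applies.
  set g : ℕ → ℝ → ℝ := fun n s => k s * z ((⌈s / δ n⌉₊ : ℝ) * δ n).toNNReal with hg
  have hgmeas (n : ℕ) : Measurable (g n) := by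
    have h : Measurable fun m : ℕ => z ((m : ℝ) * δ n).toNNReal := measurable_from_top
    exact hk.measurable.mul (h.comp (Nat.measurable_ceil.comp (by fun_prop)))
  have hgbound (n : ℕ) : ∀ s ∈ Ioc (0 : ℝ) t, ‖g n s‖ ≤ |k s| * M := by
    intro s hs
    rw [hg, norm_mul, Real.norm_eq_abs, Real.norm_eq_abs]
    gcongr
    refine hM _ (Real.toNNReal_le_iff_le_coe.2 ?_)
    have hle : ⌈s / δ n⌉₊ ≤ n + 1 := by
      rw [Nat.ceil_le, div_le_iff₀ (hδ n), hδn n]; exact hs.2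
    rw [← hδn n]
    gcongr
  have hbint : IntervalIntegrable (fun s => |k s| * M) volume 0 t :=
    (hk.abs.mul continuous_const).intervalIntegrable _ _
  have hgint (n : ℕ) : IntervalIntegrable (g n) volume 0 t := by
    refine hbint.mono_fun' (hgmeas n).aestronglyMeasurable ?_
    rw [uIoc_of_le ht'.le]
    exact (ae_restrict_mem measurableSet_Ioc).mono (hgbound n)
  have hsum (n : ℕ) : ∑ i ∈ Finset.range (n + 1),
      (∫ s in ((i : ℝ) * δ n)..((i + 1 : ℕ) * δ n), k s) * z ((i + 1 : ℕ) * δ n).toNNReal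
      = ∫ s in (0 : ℝ)..t, g n s := by
    have hle (i : ℕ) : (i : ℝ) * δ n ≤ ((i + 1 : ℕ) : ℝ) * δ n := by
      gcongr
      simp
    have h := intervalIntegral.sum_integral_adjacent_intervals (μ := volume) (f := g n)
      (a := fun i : ℕ => (i : ℝ) * δ n) (n := n + 1) fun i hi => (hgint n).mono_set (by
        rw [uIcc_of_le (hle i), uIcc_of_le ht'.le]
        refine Icc_subset_Icc (mul_nonneg i.cast_nonneg (hδ n).le) ?_
        rw [← hδn n]
        gcongr
        omega)
    rw [hδn n, Nat.cast_zero, zero_mul] at h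
    rw [← h]
    refine Finset.sum_congr rfl fun i _ => ?_
    rw [← intervalIntegral.integral_mul_const]
    refine intervalIntegral.integral_congr_ae (Eventually.of_forall fun s hs => ?_)
    rw [uIoc_of_le (hle i)] at hs
    have hceil : ⌈s / δ n⌉₊ = i + 1 := by
      rw [Nat.ceil_eq_iff (by simp), lt_div_iff₀ (hδ n), div_le_iff₀ (hδ n)]
      exact ⟨by simpa using hs.1, hs.2⟩
    simp only [hg, hceil]
  refine Tendsto.congr (fun n => (hsum n).symm) ?_
  refine intervalIntegral.tendsto_integral_filter_of_dominated_convergence _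
    (Eventually.of_forall fun n => (hgmeas n).aestronglyMeasurable)
    (Eventually.of_forall fun n => Eventually.of_forall fun s hs => hgbound n s
      (by rwa [uIoc_of_le ht'.le] at hs)) hbint (Eventually.of_forall fun s hs => ?_)
  rw [uIoc_of_le ht'.le] at hs
  exact ((hz _).1.tendsto.comp (Real.tendsto_toNNReal_nhdsGE.comp
    (tendsto_ceil_mul_nhdsGE hδ hδ₀ hs.1.le))).const_mul (k s)

/-- Riemann sums with left endpoints, for a continuous integrand. -/
lemma tendsto_riemannSum_left {G : ℝ → ℝ} (hG : Continuous G) (t : ℝ≥0) :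
    Tendsto (fun n : ℕ => ∑ i ∈ Finset.range (n + 1),
      (t / ((n : ℝ) + 1)) * G ((i : ℝ) * (t / ((n : ℝ) + 1)))) atTop
      (𝓝 (∫ s in (0 : ℝ)..t, G s)) := by
  have hz : IsCadlag fun s : ℝ≥0 => G s := .of_continuous (by fun_prop)
  have h := hz.tendsto_riemannSum (continuous_const (y := (1 : ℝ))) t
  have hδ₀ : Tendsto (fun n : ℕ => (t : ℝ) / ((n : ℝ) + 1)) atTop (𝓝 0) := by
    simpa [div_eq_mul_one_div (t : ℝ)] using
      tendsto_one_div_add_atTop_nhds_zero_nat.const_mul (t : ℝ)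
  -- Passing from right to left endpoints changes the sum by δ (G 0 - G t), which tends to 0.
  have h₂ := h.add (hδ₀.mul_const (G 0 - G t))
  have hint : ∫ s in (0 : ℝ)..t, (1 : ℝ) * G s.toNNReal = ∫ s in (0 : ℝ)..t, G s := by
    refine intervalIntegral.integral_congr fun s hs => ?_
    rw [uIcc_of_le t.coe_nonneg] at hs
    simp [Real.coe_toNNReal s hs.1]
  rw [hint, zero_mul, add_zero] at h₂
  refine h₂.congr fun n => ?_
  set δ : ℝ := t / ((n : ℝ) + 1) with hδdef
  have hδ : 0 ≤ δ := by positivity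
  have hδn : ((n + 1 : ℕ) : ℝ) * δ = t := by
    simp only [hδdef]; push_cast; field_simp
  have hterm (i : ℕ) : (∫ s in ((i : ℝ) * δ)..((i + 1 : ℕ) * δ), (1 : ℝ))
      * G ((((i + 1 : ℕ) : ℝ) * δ).toNNReal : ℝ) = δ * G (((i + 1 : ℕ) : ℝ) * δ) := by
    rw [Real.coe_toNNReal _ (by positivity)]
    congr 1
    simp; ring
  simp_rw [hterm]
  have h₁ := Finset.sum_range_succ (fun i : ℕ => δ * G ((i : ℝ) * δ)) (n + 1)
  have h₃ := Finset.sum_range_succ' (fun i : ℕ => δ * G ((i : ℝ) * δ)) (n + 1)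
  rw [h₁, hδn] at h₃
  simp only [Nat.cast_zero, zero_mul] at h₃
  linarith

/-- Almost sure convergence implies pointwise convergence of characteristic functions. -/
lemma tendsto_charFun_map {Ω : Type*} [MeasurableSpace Ω] {P : Measure Ω} [IsProbabilityMeasure P]
    {S : ℕ → Ω → ℝ} {V : Ω → ℝ} (hS : ∀ n, AEMeasurable (S n) P)
    (hlim : ∀ᵐ ω ∂P, Tendsto (fun n => S n ω) atTop (𝓝 (V ω))) (h : ℝ) :
    Tendsto (fun n => charFun (P.map (S n)) h) atTop (𝓝 (charFun (P.map V) h)) := by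
  have hV : AEMeasurable V P := aemeasurable_of_tendsto_metrizable_ae atTop hS hlim
  have hexp (U : Ω → ℝ) (hU : AEMeasurable U P) : charFun (P.map U) h
      = ∫ ω, Complex.exp (h * U ω * Complex.I) ∂P := by
    rw [charFun_apply_real, integral_map hU]
    exact (by fun_prop : Continuous fun u : ℝ =>
      Complex.exp (h * u * Complex.I)).aestronglyMeasurable
  simp_rw [hexp V hV, fun n => hexp (S n) (hS n)]
  have hc : Continuous fun u : ℝ => Complex.exp (h * u * Complex.I) := by fun_prop
  refine tendsto_integral_of_dominated_convergence (fun _ => (1 : ℝ))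
    (fun n => (hc.measurable.comp_aemeasurable (hS n)).aestronglyMeasurable)
    (integrable_const _) (fun n => Eventually.of_forall fun ω => ?_)
    (hlim.mono fun ω hω => (hc.tendsto _).comp hω)
  rw [← Complex.ofReal_mul, Complex.norm_exp_ofReal_mul_I]

namespace IsSymmetricStableProcess

variable {Ω : Type*} [MeasurableSpace Ω] {P : Measure Ω} [IsProbabilityMeasure P] {α κ : ℝ}
  {L : ℝ≥0 → Ω → ℝ}

/-- The integral `a L_t + ∫₀ᵗ k L ds` has the stable law given by the exponent
`κ ∫₀ᵗ |a + ∫ᵣᵗ k| ^ α dr`. -/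
lemma charFun_integral (hL : IsSymmetricStableProcess α κ L P) (hα : 0 < α) {k : ℝ → ℝ}
    (hk : Continuous k) (a : ℝ) (t : ℝ≥0) :
    AEMeasurable (fun ω => a * L t ω + ∫ s in (0 : ℝ)..t, k s * L s.toNNReal ω) P ∧
    ∀ h : ℝ, charFun (P.map fun ω => a * L t ω + ∫ s in (0 : ℝ)..t, k s * L s.toNNReal ω) h
      = (Real.exp (-(κ * |h| ^ α * ∫ r in (0 : ℝ)..t, |a + ∫ s in r..t, k s| ^ α)) : ℂ) := by
  set c : ℝ → ℝ := fun r => a + ∫ s in r..t, k s with hc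
  have hki (u v : ℝ) : IntervalIntegrable k volume u v := hk.intervalIntegrable u v
  have hcc : Continuous c := by
    have h : Continuous fun r => a - ∫ s in (t : ℝ)..r, k s :=
      continuous_const.sub (intervalIntegral.continuous_primitive hki _)
    exact h.congr fun r => by rw [hc, intervalIntegral.integral_symm, sub_neg_eq_add]
  -- The integral equals ∫₀ᵗ c dL formally; these are its left-endpoint sums, whose terms are
  -- independent.
  set S : ℕ → Ω → ℝ := fun n ω => ∑ j ∈ Finset.range (n + 1),
    c (j * (t / ((n : ℝ) + 1))) * (L ((j + 1 : ℕ) * (t / ((n : ℝ) + 1))).toNNReal ω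
      - L (j * (t / ((n : ℝ) + 1))).toNNReal ω) with hS
  have hSm (n : ℕ) : AEMeasurable (S n) P := by
    have h (i : ℕ) := (((hL.aemeasurable ((i + 1 : ℕ) * (t / ((n : ℝ) + 1))).toNNReal).sub
      (hL.aemeasurable (i * (t / ((n : ℝ) + 1))).toNNReal)).const_mul
        (c (i * (t / ((n : ℝ) + 1)))))
    exact Finset.aemeasurable_fun_sum _ fun i _ => h i
  have hlim : ∀ᵐ ω ∂P, Tendsto (fun n => S n ω) atTop
      (𝓝 (a * L t ω + ∫ s in (0 : ℝ)..t, k s * L s.toNNReal ω)) := by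
    filter_upwards [hL.cadlag, hL.start_zero] with ω hω h0
    refine ((hω.tendsto_riemannSum hk t).const_add (a * L t ω)).congr fun n => ?_
    set δ : ℝ := t / ((n : ℝ) + 1) with hδdef
    have hδn : ((n + 1 : ℕ) : ℝ) * δ = t := by
      simp only [hδdef]; push_cast; field_simp
    -- Summation by parts, using L₀ = 0. At the last grid point c(t) = a, which produces the
    -- boundary term a L_t.
    have habel (m : ℕ) : ∑ j ∈ Finset.range m,
        c (j * δ) * (L ((j + 1 : ℕ) * δ).toNNReal ω - L (j * δ).toNNReal ω)
        = c (m * δ) * L (m * δ).toNNReal ω + ∑ i ∈ Finset.range m,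
          (∫ s in ((i : ℝ) * δ)..((i + 1 : ℕ) * δ), k s) * L ((i + 1 : ℕ) * δ).toNNReal ω := by
      induction m with
      | zero => simp [h0]
      | succ m ih =>
        rw [Finset.sum_range_succ, Finset.sum_range_succ, ih]
        have : c (m * δ) = c ((m + 1 : ℕ) * δ)
            + ∫ s in ((m : ℝ) * δ)..((m + 1 : ℕ) * δ), k s := by
          simp only [hc]
          rw [← intervalIntegral.integral_add_adjacent_intervals (hki (m * δ) ((m + 1 : ℕ) * δ))
            (hki _ t)]
          ring
        rw [this]
        ring
    have := habel (n + 1)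
    rw [hδn] at this
    simp only [hc, intervalIntegral.integral_same, add_zero, Real.toNNReal_coe] at this
    exact this.symm
  refine ⟨aemeasurable_of_tendsto_metrizable_ae atTop hSm hlim, fun h => ?_⟩
  refine tendsto_nhds_unique (tendsto_charFun_map hSm hlim h) ?_
  have hG : Continuous fun r => κ * |h| ^ α * |c r| ^ α :=
    continuous_const.mul (hcc.abs.rpow_const fun _ => Or.inr hα.le)
  have hR := (tendsto_riemannSum_left hG t).neg.rexp.ofReal
  rw [intervalIntegral.integral_const_mul] at hR
  refine (hR : Tendsto _ _ (𝓝 _)).congr fun n => ?_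
  set δ : ℝ := t / ((n : ℝ) + 1) with hδdef
  have hδ : 0 ≤ δ := by positivity
  have hmono : Monotone fun i : ℕ => ((i : ℝ) * δ).toNNReal := fun i j hij =>
    Real.toNNReal_le_toNNReal (by gcongr)
  have hind := ((hL.indep_increments.nat hmono).comp (fun i : ℕ => fun u : ℝ => c (i * δ) * u)
    fun i => by fun_prop)
  have hmeas (i : ℕ) : AEMeasurable (fun ω => L ((i + 1 : ℕ) * δ).toNNReal ω
      - L (i * δ).toNNReal ω) P := ((hL.aemeasurable ((i + 1 : ℕ) * δ).toNNReal).sub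
    (hL.aemeasurable (i * δ).toNNReal))
  have hprod := iIndepFun.charFun_map_fun_finsetSum_eq_prod (s := Finset.range (n + 1))
    (fun i _ => (hmeas i).const_mul (c (i * δ))) (hind.restrict _)
  have hS' : charFun (P.map (S n)) h = ∏ i ∈ Finset.range (n + 1),
      charFun (P.map fun ω => c (i * δ) * (L ((i + 1 : ℕ) * δ).toNNReal ω
        - L (i * δ).toNNReal ω)) h := by
    have := congrFun hprod h
    rw [Finset.prod_apply] at this
    exact this
  rw [hS', ← Finset.sum_neg_distrib, Real.exp_sum, Complex.ofReal_prod]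
  refine Finset.prod_congr rfl fun i _ => ?_
  rw [charFun_map_mul_comp (hmeas i), hL.charFun_increment _ _ (hmono i.le_succ),
    Real.coe_toNNReal _ (by positivity), Real.coe_toNNReal _ (by positivity), abs_mul,
    Real.mul_rpow (abs_nonneg _) (abs_nonneg _)]
  congr 3
  push_cast
  ring

end IsSymmetricStableProcess

/-! ### Fractional moments in terms of characteristic functions -/

/-- `∫₀^∞ (1 - exp (-c h ^ a)) h ^ (-1 - p) dh = c ^ (p / a) Γ(1 - p / a) / p`. -/
lemma lintegral_one_sub_exp_neg_mul_rpow {a p c : ℝ} (hp : 0 < p) (hpa : p < a) (hc : 0 ≤ c) :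
    ∫⁻ h in Ioi (0 : ℝ), ENNReal.ofReal ((1 - Real.exp (-(c * h ^ a))) * h ^ (-1 - p))
      = ENNReal.ofReal (c ^ (p / a) * Real.Gamma (1 - p / a) / p) := by
  have ha : 0 < a := hp.trans hpa
  have hpa' : p / a < 1 := (div_lt_one ha).2 hpa
  rcases hc.eq_or_lt with rfl | hc
  · simp [Real.zero_rpow (div_pos hp ha).ne']
  -- Write 1 - exp(-u) = ∫₀ᵘ exp(-v) dv with u = c h^a and exchange the order of integration over
  -- the region v < c h^a. The inner integral in h is then a pure power, and the outer one a Gamma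
  -- integral.
  set B : ℝ × ℝ → ℝ≥0∞ := fun q => {q : ℝ × ℝ | q.2 < c * q.1 ^ a}.indicator
    (fun q => ENNReal.ofReal (Real.exp (-q.2)) * ENNReal.ofReal (q.1 ^ (-1 - p))) q with hB
  have hBm : Measurable B :=
    Measurable.indicator (by fun_prop) (measurableSet_lt (by fun_prop) (by fun_prop))
  have h₁ : ∀ h ∈ Ioi (0 : ℝ), ENNReal.ofReal ((1 - Real.exp (-(c * h ^ a))) * h ^ (-1 - p))
      = ∫⁻ v in Ioi (0 : ℝ), B (h, v) := by
    intro h hh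
    have hh' : (0 : ℝ) < h := hh
    have hu : 0 ≤ c * h ^ a := by positivity
    have hint : ∫ v in (0 : ℝ)..(c * h ^ a), Real.exp (-v) = 1 - Real.exp (-(c * h ^ a)) := by
      simp
    have hind : (fun v => B (h, v)) = (Iio (c * h ^ a)).indicator
        fun v => ENNReal.ofReal (Real.exp (-v)) * ENNReal.ofReal (h ^ (-1 - p)) := by
      ext v; simp [hB, indicator]
    rw [hind, lintegral_indicator measurableSet_Iio, Measure.restrict_restrict measurableSet_Iio,
      inter_comm, Ioi_inter_Iio, lintegral_mul_const _ (by fun_prop),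
      ← ofReal_integral_eq_lintegral_ofReal, ← integral_Ioc_eq_integral_Ioo,
      ← intervalIntegral.integral_of_le hu, hint, ENNReal.ofReal_mul]
    · simpa using hu
    · exact ((by fun_prop : Continuous fun v : ℝ => Real.exp (-v)).integrableOn_Icc
        (a := 0) (b := c * h ^ a)).mono_set Ioo_subset_Icc_self
    · exact Eventually.of_forall fun v => (Real.exp_pos _).le
  have h₂ : ∀ v ∈ Ioi (0 : ℝ), ∫⁻ h in Ioi (0 : ℝ), B (h, v)
      = ENNReal.ofReal (c ^ (p / a) / p * (Real.exp (-v) * v ^ ((1 - p / a) - 1))) := by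
    intro v hv
    have hv' : (0 : ℝ) < v := hv
    have hvc : 0 < v / c := by positivity
    set d : ℝ := (v / c) ^ (1 / a) with hd
    have hdpos : 0 < d := Real.rpow_pos_of_pos hvc _
    have hind : ∀ h ∈ Ioi (0 : ℝ), B (h, v) = (Ioi d).indicator
        (fun h => ENNReal.ofReal (Real.exp (-v)) * ENNReal.ofReal (h ^ (-1 - p))) h := by
      intro h hh
      have hh' : (0 : ℝ) < h := hh
      have hiff : v < c * h ^ a ↔ d < h := by
        rw [hd, one_div, Real.rpow_inv_lt_iff_of_pos hvc.le hh'.le ha, div_lt_iff₀ hc, mul_comm]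
      simp [hB, indicator, hiff]
    rw [setLIntegral_congr_fun measurableSet_Ioi hind, lintegral_indicator measurableSet_Ioi,
      Measure.restrict_restrict measurableSet_Ioi,
      inter_eq_left.2 (Ioi_subset_Ioi hdpos.le), lintegral_const_mul _ (by fun_prop),
      ← ofReal_integral_eq_lintegral_ofReal (integrableOn_Ioi_rpow_of_lt (by linarith) hdpos),
      integral_Ioi_rpow_of_lt (by linarith) hdpos, ← ENNReal.ofReal_mul (Real.exp_pos _).le]
    · congr 1
      have e₁ : d ^ (-1 - p + 1) = v ^ (1 - p / a - 1) * c ^ (p / a) := by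
        rw [hd, ← Real.rpow_mul hvc.le, Real.div_rpow hv'.le hc.le,
          show 1 / a * (-1 - p + 1) = -(p / a) by ring, Real.rpow_neg hc.le, div_inv_eq_mul,
          show 1 - p / a - 1 = -(p / a) by ring]
      rw [e₁]
      have : (-1 - p + 1) = -p := by ring
      rw [this]
      field_simp
    · exact (ae_restrict_mem measurableSet_Ioi).mono fun h hh =>
        Real.rpow_nonneg (hdpos.le.trans (le_of_lt hh)) _
  rw [setLIntegral_congr_fun measurableSet_Ioi h₁, lintegral_lintegral_swap hBm.aemeasurable,
    setLIntegral_congr_fun measurableSet_Ioi h₂, ← ofReal_integral_eq_lintegral_ofReal,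
    integral_const_mul, ← Real.Gamma_eq_integral (by linarith)]
  · congr 1; ring
  · exact (Real.GammaIntegral_convergent (by linarith)).const_mul _
  · refine (ae_restrict_mem measurableSet_Ioi).mono fun v hv => ?_
    have hv' : (0 : ℝ) < v := hv
    simp only [Pi.zero_apply]
    positivity

/-- The scaling identity behind `|x| ^ p = I⁻¹ ∫₀^∞ (1 - cos (h x)) h ^ (-1 - p) dh`. -/
lemma lintegral_one_sub_cos_mul {p : ℝ} (hp : 0 < p) (x : ℝ) :
    ∫⁻ h in Ioi (0 : ℝ), ENNReal.ofReal ((1 - Real.cos (h * x)) * h ^ (-1 - p))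
      = ENNReal.ofReal (|x| ^ p)
        * ∫⁻ h in Ioi (0 : ℝ), ENNReal.ofReal ((1 - Real.cos h) * h ^ (-1 - p)) := by
  rcases eq_or_ne x 0 with rfl | hx
  · simp [Real.zero_rpow hp.ne']
  have hx' : 0 < |x| := abs_pos.2 hx
  have himg : (fun h : ℝ => |x| * h) '' Ioi 0 = Ioi 0 := by
    rw [image_mul_left_Ioi hx', mul_zero]
  have h := lintegral_image_eq_lintegral_abs_deriv_mul (s := Ioi (0 : ℝ)) (f := fun h => |x| * h)
    (f' := fun _ => |x|) measurableSet_Ioi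
    (fun h _ => by simpa using ((hasDerivAt_id h).const_mul |x|).hasDerivWithinAt)
    (mul_right_injective₀ hx'.ne').injOn
    (fun h => ENNReal.ofReal ((1 - Real.cos h) * h ^ (-1 - p)))
  rw [himg] at h
  rw [h, ← lintegral_const_mul _ (by fun_prop)]
  refine setLIntegral_congr_fun measurableSet_Ioi fun u hu => ?_
  have hu' : (0 : ℝ) < u := hu
  have hcos : Real.cos (|x| * u) = Real.cos (u * x) := by
    rcases abs_choice x with h | h <;> rw [h]
    · rw [mul_comm]
    · rw [neg_mul, Real.cos_neg, mul_comm]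
  rw [abs_abs, ← ENNReal.ofReal_mul hx'.le, ← ENNReal.ofReal_mul (by positivity), hcos,
    Real.mul_rpow hx'.le hu'.le]
  congr 1
  have : |x| ^ p * (|x| * |x| ^ (-1 - p)) = 1 := by
    nth_rewrite 2 [← Real.rpow_one |x|]
    rw [← Real.rpow_add hx', ← Real.rpow_add hx', show p + (1 + (-1 - p)) = 0 by ring,
      Real.rpow_zero]
  linear_combination (-(1 - Real.cos (u * x)) * u ^ (-1 - p)) * this

/-- Fractional moments through the real part of the characteristic function. -/
lemma lintegral_abs_rpow_mul {μ : Measure ℝ} [IsProbabilityMeasure μ] {φ : ℝ → ℝ}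
    (hφ : ∀ h, charFun μ h = φ h) {p : ℝ} (hp : 0 < p) :
    (∫⁻ x, ENNReal.ofReal (|x| ^ p) ∂μ)
        * ∫⁻ h in Ioi (0 : ℝ), ENNReal.ofReal ((1 - Real.cos h) * h ^ (-1 - p))
      = ∫⁻ h in Ioi (0 : ℝ), ENNReal.ofReal ((1 - φ h) * h ^ (-1 - p)) := by
  have hcos (h : ℝ) : Integrable (fun x => Real.cos (h * x)) μ :=
    (integrable_const (1 : ℝ)).mono' (by fun_prop)
      (Eventually.of_forall fun x => Real.abs_cos_le_one _)
  have hre (h : ℝ) : ∫ x, Real.cos (h * x) ∂μ = φ h := by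
    have hint : Integrable (fun x : ℝ => Complex.exp (h * x * Complex.I)) μ := by
      refine (integrable_const (1 : ℝ)).mono' (by fun_prop) (Eventually.of_forall fun x => ?_)
      rw [← Complex.ofReal_mul, Complex.norm_exp_ofReal_mul_I]
    have h₁ : (∫ x : ℝ, Complex.exp (h * x * Complex.I) ∂μ).re = φ h := by
      rw [← charFun_apply_real, hφ, Complex.ofReal_re]
    rw [← h₁, ← Complex.reCLM_apply, ← Complex.reCLM.integral_comp_comm hint]
    refine integral_congr_ae (Eventually.of_forall fun x => ?_)
    simp only [Complex.reCLM_apply]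
    rw [← Complex.ofReal_mul, Complex.exp_ofReal_mul_I_re]
  -- With values in `ℝ≥0∞`, Tonelli applies before the moment is known to be finite; integrability
  -- is deduced afterwards from the value.
  rw [← lintegral_mul_const _ (by fun_prop)]
  simp_rw [← lintegral_one_sub_cos_mul hp]
  rw [lintegral_lintegral_swap (by fun_prop)]
  refine setLIntegral_congr_fun measurableSet_Ioi fun h hh => ?_
  have hh' : (0 : ℝ) < h := hh
  rw [← ofReal_integral_eq_lintegral_ofReal, integral_mul_const,
    integral_sub (integrable_const _) (hcos h), hre]
  · simp
  · exact ((integrable_const _).sub (hcos h)).mul_const _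
  · exact Eventually.of_forall fun x =>
      mul_nonneg (sub_nonneg.2 (Real.cos_le_one _)) (Real.rpow_nonneg hh'.le _)

lemma lintegral_abs_rpow_gaussianReal {p : ℝ} (hp : 0 < p) :
    ∫⁻ x, ENNReal.ofReal (|x| ^ p) ∂(gaussianReal 0 1)
      = ENNReal.ofReal (2 ^ (p / 2) * Real.Gamma ((1 + p) / 2) / √Real.pi) := by
  have hΓ : 0 < Real.Gamma ((1 + p) / 2) := Real.Gamma_pos_of_pos (by linarith)
  have hval : ∫ x, |x| ^ p ∂(gaussianReal 0 1)
      = 2 ^ (p / 2) * Real.Gamma ((1 + p) / 2) / √Real.pi := by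
    rw [integral_gaussianReal_eq_integral_smul one_ne_zero]
    set f : ℝ → ℝ := fun y => (√(2 * Real.pi))⁻¹ * (y ^ p * Real.exp (-(1 / 2) * y ^ (2 : ℝ)))
      with hf
    have h₁ : ∀ x : ℝ, gaussianPDFReal 0 1 x • |x| ^ p = f |x| := by
      intro x
      rw [hf, gaussianPDFReal_def]
      simp only [smul_eq_mul, NNReal.coe_one, mul_one, sub_zero, Real.rpow_two, sq_abs]
      rw [show -x ^ 2 / 2 = -(1 / 2) * x ^ 2 by ring]
      ring
    refine (integral_congr_ae (Eventually.of_forall h₁)).trans ((integral_comp_abs (f := f)).trans ?_)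
    rw [hf, integral_const_mul,
      integral_rpow_mul_exp_neg_mul_rpow two_pos (by linarith) (by norm_num),
      Real.sqrt_mul two_pos.le, one_div, Real.inv_rpow two_pos.le, ← Real.rpow_neg two_pos.le,
      show -(-(p + 1) / 2) = p / 2 + 1 / 2 by ring, Real.rpow_add two_pos, ← Real.sqrt_eq_rpow,
      add_comm p 1]
    have : √(2 : ℝ) ≠ 0 := by positivity
    have : √Real.pi ≠ 0 := by positivity
    field_simp
  have hint : Integrable (fun x => |x| ^ p) (gaussianReal 0 1) := by
    -- A non-integrable function has Bochner integral 0 by convention, whereas the value in `hval`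
    -- is positive.
    by_contra h
    rw [integral_undef h] at hval
    exact absurd hval (by positivity)
  rw [← ofReal_integral_eq_lintegral_ofReal hint
    (Eventually.of_forall fun x => Real.rpow_nonneg (abs_nonneg x) p), hval]

/-- This universal constant is obtained from `lintegral_abs_rpow_mul` for the standard Gaussian,
where both the moment and the integral of 1 - φ are explicit; the oscillatory integral is never
evaluated directly. -/
lemma lintegral_one_sub_cos {p : ℝ} (hp : 0 < p) (hp2 : p < 2) :
    ∫⁻ h in Ioi (0 : ℝ), ENNReal.ofReal ((1 - Real.cos h) * h ^ (-1 - p))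
      = ENNReal.ofReal (√Real.pi * Real.Gamma (1 - p / 2)
          / (p * 2 ^ p * Real.Gamma ((1 + p) / 2))) := by
  have hΓ : 0 < Real.Gamma ((1 + p) / 2) := Real.Gamma_pos_of_pos (by linarith)
  have hφ (h : ℝ) : charFun (gaussianReal 0 1) h = (Real.exp (-(1 / 2 * h ^ 2)) : ℂ) := by
    rw [charFun_gaussianReal]
    push_cast
    congr 1
    ring
  have h := lintegral_abs_rpow_mul hφ hp
  have hJ := lintegral_one_sub_exp_neg_mul_rpow (a := 2) (c := 1 / 2) hp hp2 (by norm_num)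
  simp_rw [Real.rpow_two] at hJ
  rw [hJ, lintegral_abs_rpow_gaussianReal hp] at h
  have hM : 0 < 2 ^ (p / 2) * Real.Gamma ((1 + p) / 2) / √Real.pi := by positivity
  rw [ENNReal.eq_div_iff (ENNReal.ofReal_pos.2 hM).ne' ENNReal.ofReal_ne_top |>.2 h,
    ← ENNReal.ofReal_div_of_pos hM]
  congr 1
  rw [one_div, Real.inv_rpow two_pos.le,
    show (2 : ℝ) ^ p = 2 ^ (p / 2) * 2 ^ (p / 2) by rw [← Real.rpow_add two_pos]; ring_nf]
  field_simp

lemma stableMoment_pos {α p : ℝ} (hα : α < 2) (hp : 0 < p) (hpα : p < α) :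
    0 < stableMoment α p := by
  have h₁ : p / α < 1 := (div_lt_one (hp.trans hpα)).2 hpα
  have h₂ := Real.Gamma_pos_of_pos (show 0 < (1 + p) / 2 by linarith)
  have h₃ := Real.Gamma_pos_of_pos (show 0 < 1 - p / α by linarith)
  have h₄ := Real.Gamma_pos_of_pos (show 0 < 1 - p / 2 by linarith)
  unfold stableMoment
  positivity

/-- The `p`-th absolute moment of a symmetric stable law. -/
lemma stable_moment {μ : Measure ℝ} [IsProbabilityMeasure μ] {α c : ℝ} (hα : α < 2) (hc : 0 ≤ c)
    (hμ : ∀ h, charFun μ h = (Real.exp (-(c * |h| ^ α)) : ℂ)) {p : ℝ} (hp : 0 < p)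
    (hpα : p < α) :
    Integrable (fun x => |x| ^ p) μ ∧ ∫ x, |x| ^ p ∂μ = stableMoment α p * c ^ (p / α) := by
  have hα₀ : 0 < α := hp.trans hpα
  have h₂ := Real.Gamma_pos_of_pos (show 0 < (1 + p) / 2 by linarith)
  have h₄ := Real.Gamma_pos_of_pos (show 0 < 1 - p / 2 by linarith)
  have h := lintegral_abs_rpow_mul hμ hp
  have hJ : ∫⁻ h in Ioi (0 : ℝ), ENNReal.ofReal ((1 - Real.exp (-(c * |h| ^ α))) * h ^ (-1 - p))
      = ENNReal.ofReal (c ^ (p / α) * Real.Gamma (1 - p / α) / p) := by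
    rw [← lintegral_one_sub_exp_neg_mul_rpow hp hpα hc]
    refine setLIntegral_congr_fun measurableSet_Ioi fun u hu => ?_
    simp only [abs_of_pos (show (0 : ℝ) < u from hu)]
  have hI : 0 < √Real.pi * Real.Gamma (1 - p / 2) / (p * 2 ^ p * Real.Gamma ((1 + p) / 2)) := by
    positivity
  have hE : ∫⁻ x, ENNReal.ofReal (|x| ^ p) ∂μ = ENNReal.ofReal (stableMoment α p * c ^ (p / α)) := by
    rw [hJ, lintegral_one_sub_cos hp (hpα.trans hα), mul_comm] at h
    rw [ENNReal.eq_div_iff (ENNReal.ofReal_pos.2 hI).ne' ENNReal.ofReal_ne_top |>.2 h,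
      ← ENNReal.ofReal_div_of_pos hI]
    congr 1
    unfold stableMoment
    field_simp
  have hnn : 0 ≤ᵐ[μ] fun x => |x| ^ p :=
    Eventually.of_forall fun x => Real.rpow_nonneg (abs_nonneg x) p
  have hmeas : AEStronglyMeasurable (fun x : ℝ => |x| ^ p) μ := by fun_prop (disch := exact hp.le)
  refine ⟨(lintegral_ofReal_ne_top_iff_integrable hmeas hnn).1 (by simp [hE]), ?_⟩
  rw [integral_eq_lintegral_of_nonneg_ae hnn hmeas, hE, ENNReal.toReal_ofReal]
  exact mul_nonneg (stableMoment_pos hα hp hpα).le (Real.rpow_nonneg hc _)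

/-- A symmetric law has mean zero. -/
lemma integral_eq_zero_of_charFun_even {μ : Measure ℝ} [IsProbabilityMeasure μ]
    (hμ : ∀ h, charFun μ (-h) = charFun μ h) : ∫ x, x ∂μ = 0 := by
  have h : μ.map (fun x => -1 * x) = μ := by
    have := Measure.isProbabilityMeasure_map (μ := μ) (f := fun x : ℝ => -1 * x) (by fun_prop)
    refine Measure.ext_of_charFun (funext fun u => ?_)
    rw [charFun_map_mul, neg_one_mul, hμ]
  have h₂ : ∫ x, x ∂(μ.map fun x => -1 * x) = -∫ x, x ∂μ := by
    rw [integral_map (by fun_prop) (by fun_prop), integral_const_mul, neg_one_mul]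
  rw [h] at h₂
  linarith

/-! ### Asymptotics of the error constant -/

lemma tendsto_integral_one_sub_exp {α : ℝ} (hα : 0 < α) (t : ℝ≥0) :
    Tendsto (fun ε : ℝ => ∫ r in (0 : ℝ)..t, (1 - Real.exp (-(r / ε))) ^ α) (𝓝[>] 0)
      (𝓝 (t : ℝ)) := by
  suffices h : Tendsto (fun ε : ℝ => ∫ r in (0 : ℝ)..t, (1 - Real.exp (-(r / ε))) ^ α) (𝓝[>] 0)
      (𝓝 (∫ _ in (0 : ℝ)..t, (1 : ℝ))) by simpa using h
  refine intervalIntegral.tendsto_integral_filter_of_dominated_convergence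
    (fun _ => (1 : ℝ))
    (Eventually.of_forall fun ε => ?_) ?_ intervalIntegrable_const
    (Eventually.of_forall fun r hr => ?_)
  · exact (by fun_prop : Measurable fun r : ℝ => (1 - Real.exp (-(r / ε))) ^ α).aestronglyMeasurable
  · filter_upwards [self_mem_nhdsWithin] with ε hε
    refine Eventually.of_forall fun r hr => ?_
    rw [uIoc_of_le t.coe_nonneg] at hr
    have h₁ : Real.exp (-(r / ε)) ≤ 1 :=
      Real.exp_le_one_iff.2 (neg_nonpos.2 (div_nonneg hr.1.le (le_of_lt hε)))
    have h₂ := Real.exp_pos (-(r / ε))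
    rw [Real.norm_of_nonneg (Real.rpow_nonneg (by linarith) _)]
    exact Real.rpow_le_one (by linarith) (by linarith) hα.le
  · rw [uIoc_of_le t.coe_nonneg] at hr
    have h : Tendsto (fun ε : ℝ => r / ε) (𝓝[>] 0) atTop := by
      simpa [div_eq_mul_inv] using tendsto_inv_nhdsGT_zero.const_mul_atTop hr.1
    have h₂ := (Real.tendsto_exp_neg_atTop_nhds_zero.comp h).const_sub 1
    rw [sub_zero] at h₂
    simpa using h₂.rpow_const (p := α) (Or.inl one_ne_zero)

/-- A quantity of exact order `ε ^ a` is not of order `ε ^ b` for `b > a`. -/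
lemma not_le_mul_rpow_of_tendsto {E : ℝ → ℝ} {a b m : ℝ} (hm : 0 < m) (hab : a < b)
    (hE : Tendsto (fun ε => E ε / ε ^ a) (𝓝[>] 0) (𝓝 m)) :
    ¬ ∃ C : ℝ, ∀ᶠ ε in 𝓝[>] (0 : ℝ), E ε ≤ C * ε ^ b := by
  rintro ⟨C, hC⟩
  have h₀ : Tendsto (fun ε : ℝ => C * ε ^ (b - a)) (𝓝[>] 0) (𝓝 0) := by
    have h : Tendsto (fun ε : ℝ => ε ^ (b - a)) (𝓝[>] 0) (𝓝 (0 ^ (b - a))) :=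
      (Real.continuousAt_rpow_const 0 (b - a) (Or.inr (by linarith))).tendsto.mono_left
        nhdsWithin_le_nhds
    rw [Real.zero_rpow (by linarith)] at h
    simpa using h.const_mul C
  refine absurd (le_of_tendsto_of_tendsto hE h₀ ?_) (not_le.2 hm)
  filter_upwards [hC, self_mem_nhdsWithin] with ε hε hpos
  have hpos' : (0 : ℝ) < ε := hpos
  rw [div_le_iff₀ (Real.rpow_pos_of_pos hpos' _), mul_assoc, ← Real.rpow_add hpos',
    sub_add_cancel]
  exact hε

/-! ### The slow-fast system and the frozen equation -/

lemma integral_exp_decay {r : ℝ} (hr : 0 < r) (c u t : ℝ) :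
    ∫ s in u..t, c * Real.exp (-(r * (t - s))) = c / r * (1 - Real.exp (-(r * (t - u)))) := by
  rw [intervalIntegral.integral_eq_sub_of_hasDerivAt
    (f := fun s => c / r * Real.exp (-(r * (t - s))))]
  · simp; ring
  · intro s _
    have h := (((((hasDerivAt_id s).const_sub t).const_mul r).neg).exp).const_mul (c / r)
    refine h.congr_deriv ?_
    simp
    field_simp
  · exact (by fun_prop : Continuous fun s : ℝ =>
      c * Real.exp (-(r * (t - s)))).intervalIntegrable _ _

lemma expConv_const_mul (r c : ℝ) (l : ℝ≥0 → ℝ) (t : ℝ) :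
    expConv r (fun s => c * l s) t
      = ∫ s in (0 : ℝ)..t, c * Real.exp (-(r * (t - s))) * l s.toNNReal := by
  unfold expConv
  congr 1 with s
  ring

section

variable {Ω : Type*} [MeasurableSpace Ω] {P : Measure Ω}
  {α κ κ₁ κ₂ : ℝ} {L L₁ L₂ : ℝ≥0 → Ω → ℝ}

lemma IsSlowFastSolution.fast_eq_ouPath {ε x : ℝ} {X Y : ℝ≥0 → Ω → ℝ}
    (hL₂ : IsSymmetricStableProcess α κ₂ L₂ P)
    (h : IsSlowFastSolution slowDrift fastDrift α ε L₁ L₂ x 0 X Y P) :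
    ∀ᵐ ω ∂P, ∀ t, Y t ω = ouPath (1 / ε) 0 (fun s => 1 / ε ^ (1 / α) * L₂ s ω) t := by
  filter_upwards [hL₂.cadlag, h.cadlag_fast, h.fast_eq] with ω h₂ hY hYeq t
  have hl := h₂.const_mul (1 / ε ^ (1 / α))
  exact SolvesIntegralEq.unique hY (hl.ouPath _ _) hYeq (ouPath_solves hl _ _) t

/-- Since Y starts at 0, it equals l - r · (convolution), and its time integral is the convolution
itself. The averaging error is thus a single functional of L₂. -/
lemma IsSlowFastSolution.slow_eq_expConv {ε x : ℝ} {X Y : ℝ≥0 → Ω → ℝ}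
    (hL₂ : IsSymmetricStableProcess α κ₂ L₂ P)
    (h : IsSlowFastSolution slowDrift fastDrift α ε L₁ L₂ x 0 X Y P) :
    ∀ᵐ ω ∂P, ∀ t : ℝ≥0,
      X t ω = x + expConv (1 / ε) (fun s => 1 / ε ^ (1 / α) * L₂ s ω) t + L₁ t ω := by
  filter_upwards [hL₂.cadlag, h.fast_eq_ouPath hL₂, h.slow_eq] with ω h₂ hY hX t
  refine (hX t).2.trans ?_
  rw [← integral_sub_expConv (h₂.const_mul (1 / ε ^ (1 / α))) (1 / ε) t]
  simp only [slowDrift, hY, ouPath, zero_mul, zero_add]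

lemma IsSDESolution.eq_ouPath {x y : ℝ} {Y : ℝ≥0 → Ω → ℝ}
    (hL : IsSymmetricStableProcess α κ L P) (h : IsSDESolution (fastDrift x) L y Y P) :
    ∀ᵐ ω ∂P, ∀ t, Y t ω = ouPath 1 y (fun s => L s ω) t := by
  filter_upwards [hL.cadlag, h.cadlag, h.eq] with ω hl hY hYeq t
  refine SolvesIntegralEq.unique hY (hl.ouPath _ _) ?_ (ouPath_solves hl 1 y) t
  simpa [fastDrift] using hYeq

variable [IsProbabilityMeasure P]

lemma IsSymmetricStableProcess.aemeasurable_expConv (hL : IsSymmetricStableProcess α κ L P)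
    (hα : 0 < α) (r c : ℝ) (t : ℝ≥0) :
    AEMeasurable (fun ω => expConv r (fun s => c * L s ω) t) P := by
  have h := (hL.charFun_integral hα
    (k := fun s => c * Real.exp (-(r * (t - s)))) (by fun_prop) 0 t).1
  simpa [expConv_const_mul r c (fun s => L s _)] using h

lemma IsSymmetricStableProcess.aemeasurable_ouPath (hL : IsSymmetricStableProcess α κ L P)
    (hα : 0 < α) (r y c : ℝ) (t : ℝ≥0) :
    AEMeasurable (fun ω => ouPath r y (fun s => c * L s ω) t) P :=
  (((hL.aemeasurable t).const_mul c).const_add _).sub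
    ((hL.aemeasurable_expConv hα r c t).const_mul r)

lemma exists_isSlowFastSolution (hα : 0 < α) (hL₁ : IsSymmetricStableProcess α κ₁ L₁ P)
    (hL₂ : IsSymmetricStableProcess α κ₂ L₂ P) (ε x : ℝ) :
    ∃ X Y, IsSlowFastSolution slowDrift fastDrift α ε L₁ L₂ x 0 X Y P := by
  refine ⟨fun t ω => x + expConv (1 / ε) (fun s => 1 / ε ^ (1 / α) * L₂ s ω) t + L₁ t ω,
    fun t ω => ouPath (1 / ε) 0 (fun s => 1 / ε ^ (1 / α) * L₂ s ω) t,
    fun t => ((hL₂.aemeasurable_expConv hα _ _ t).const_add x).add (hL₁.aemeasurable t),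
    fun t => hL₂.aemeasurable_ouPath hα _ _ _ t, ?_, ?_, ?_, ?_⟩
  · filter_upwards [hL₁.cadlag, hL₂.cadlag] with ω h₁ h₂
    exact ((IsCadlag.of_continuous continuous_const).add
      ((h₂.const_mul (1 / ε ^ (1 / α))).expConv (1 / ε))).add h₁
  · filter_upwards [hL₂.cadlag] with ω h₂
    exact (h₂.const_mul (1 / ε ^ (1 / α))).ouPath _ _
  · filter_upwards [hL₂.cadlag] with ω h₂ t
    have h := h₂.const_mul (1 / ε ^ (1 / α))
    refine ⟨(h.ouPath (1 / ε) 0).intervalIntegrable 0 t, ?_⟩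
    have hI := integral_sub_expConv h (1 / ε) t
    simp only [slowDrift, ouPath, zero_mul, zero_add]
    rw [hI]
  · filter_upwards [hL₂.cadlag] with ω h₂
    exact ouPath_solves (h₂.const_mul (1 / ε ^ (1 / α))) (1 / ε) 0

lemma exists_isSDESolution_fastDrift (hα : 0 < α) (hL : IsSymmetricStableProcess α κ L P)
    (x y : ℝ) : ∃ Y, IsSDESolution (fastDrift x) L y Y P := by
  refine ⟨fun t ω => ouPath 1 y (fun s => L s ω) t, fun t => ?_, ?_, ?_⟩
  · simpa using hL.aemeasurable_ouPath hα 1 y 1 t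
  · filter_upwards [hL.cadlag] with ω hl using hl.ouPath 1 y
  · filter_upwards [hL.cadlag] with ω hl
    simpa [fastDrift] using ouPath_solves hl 1 y

/-- The exact moments of the slow component of the error. -/
lemma IsSymmetricStableProcess.moment_expConv (hL : IsSymmetricStableProcess α κ L P)
    (hα₂ : α < 2) (hκ : 0 < κ) {ε : ℝ} (hε : 0 < ε) (t : ℝ≥0) {p : ℝ} (hp : 0 < p)
    (hpα : p < α) :
    Integrable (fun ω => |expConv (1 / ε) (fun s => 1 / ε ^ (1 / α) * L s ω) t| ^ p) P ∧
    ∫ ω, |expConv (1 / ε) (fun s => 1 / ε ^ (1 / α) * L s ω) t| ^ p ∂P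
      = stableMoment α p * κ ^ (p / α)
        * (∫ r in (0 : ℝ)..t, (1 - Real.exp (-(r / ε))) ^ α) ^ (p / α)
        * ε ^ (p * (1 - 1 / α)) := by
  have hα : 0 < α := hp.trans hpα
  set D : Ω → ℝ := fun ω => expConv (1 / ε) (fun s => 1 / ε ^ (1 / α) * L s ω) t with hD
  have hDm : AEMeasurable D P := hL.aemeasurable_expConv hα _ _ t
  set J : ℝ := ∫ r in (0 : ℝ)..t, (1 - Real.exp (-(r / ε))) ^ α with hJ
  have hone (r : ℝ) (hr : 0 ≤ r) : 0 ≤ 1 - Real.exp (-(r / ε)) :=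
    sub_nonneg.2 (Real.exp_le_one_iff.2 (neg_nonpos.2 (div_nonneg hr hε.le)))
  have hJ₀ : 0 ≤ J := intervalIntegral.integral_nonneg t.coe_nonneg fun r hr =>
    Real.rpow_nonneg (hone r hr.1) _
  -- The kernel ε^(-1/α) exp(-(t-s)/ε) integrates over [r, t] to ε^(1-1/α) (1 - exp(-(t-r)/ε)). Its
  -- prefactor, raised to the power α, is the source of the rate.
  have hpow : (1 / ε ^ (1 / α) / (1 / ε)) ^ α = ε ^ (α - 1) := by
    have h₁ : 1 / ε ^ (1 / α) / (1 / ε) = ε ^ (-(1 / α)) * ε ^ (1 : ℝ) := by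
      rw [Real.rpow_neg hε.le, Real.rpow_one]
      field_simp
    rw [h₁, ← Real.rpow_add hε, ← Real.rpow_mul hε.le]
    congr 1
    field_simp
    ring
  have hchar : ∀ h, charFun (P.map D) h
      = (Real.exp (-(κ * ε ^ (α - 1) * J * |h| ^ α)) : ℂ) := by
    intro h
    have hk := (hL.charFun_integral hα
      (k := fun s => 1 / ε ^ (1 / α) * Real.exp (-(1 / ε * (t - s)))) (by fun_prop) 0 t).2 h
    have hDeq : D = fun ω => 0 * L t ω + ∫ s in (0 : ℝ)..t,
        1 / ε ^ (1 / α) * Real.exp (-(1 / ε * (t - s))) * L s.toNNReal ω := by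
      ext ω
      rw [zero_mul, zero_add]
      exact expConv_const_mul (1 / ε) _ (fun s => L s ω) t
    have hint : ∫ r in (0 : ℝ)..t,
        |0 + ∫ s in r..t, 1 / ε ^ (1 / α) * Real.exp (-(1 / ε * (t - s)))| ^ α
        = ε ^ (α - 1) * J := by
      have h₁ : ∫ r in (0 : ℝ)..t,
          |0 + ∫ s in r..t, 1 / ε ^ (1 / α) * Real.exp (-(1 / ε * (t - s)))| ^ α
          = ∫ r in (0 : ℝ)..t, ε ^ (α - 1) * (1 - Real.exp (-((t - r) / ε))) ^ α := by
        refine intervalIntegral.integral_congr fun r hr => ?_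
        rw [uIcc_of_le t.coe_nonneg] at hr
        have hr' := hone (t - r) (sub_nonneg.2 hr.2)
        rw [zero_add, integral_exp_decay (one_div_pos.2 hε), one_div_mul_eq_div, abs_of_nonneg,
          Real.mul_rpow _ hr', hpow]
        · positivity
        · exact mul_nonneg (by positivity) hr'
      rw [h₁, intervalIntegral.integral_const_mul,
        intervalIntegral.integral_comp_sub_left (fun r => (1 - Real.exp (-(r / ε))) ^ α) (t : ℝ)]
      simp [hJ]
    rw [hDeq, hk, hint]
    ring_nf
  have := Measure.isProbabilityMeasure_map (μ := P) hDm
  obtain ⟨h₁, h₂⟩ := stable_moment hα₂ (by positivity) hchar hp hpα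
  have hm : AEStronglyMeasurable (fun x : ℝ => |x| ^ p) (P.map D) := by
    fun_prop (disch := exact hp.le)
  rw [integrable_map_measure hm hDm] at h₁
  rw [integral_map hDm hm] at h₂
  refine ⟨h₁, h₂.trans ?_⟩
  rw [Real.mul_rpow (by positivity) hJ₀, Real.mul_rpow hκ.le (by positivity),
    ← Real.rpow_mul hε.le, show (α - 1) * (p / α) = p * (1 - 1 / α) by field_simp]
  ring

/-! ### The invariant law of the frozen equation -/

/-- The noise part of the frozen equation at time `t`. -/
lemma IsSymmetricStableProcess.charFun_ouPath (hL : IsSymmetricStableProcess α κ L P)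
    (hα : 0 < α) (t : ℝ≥0) (h : ℝ) :
    charFun (P.map fun ω => ouPath 1 0 (fun s => L s ω) t) h
      = (Real.exp (-(κ / α * |h| ^ α * (1 - Real.exp (-(α * t))))) : ℂ) := by
  -- With a = 1 and this k, the weight a + ∫ᵣᵗ k is exp(-(t-r)), the Ornstein–Uhlenbeck kernel.
  have hk := (hL.charFun_integral hα
    (k := fun s => -1 * Real.exp (-(1 * (t - s)))) (by fun_prop) 1 t).2 h
  have hV : (fun ω => ouPath 1 0 (fun s => L s ω) t) = fun ω => 1 * L t ω +
      ∫ s in (0 : ℝ)..t, -1 * Real.exp (-(1 * (t - s))) * L s.toNNReal ω := by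
    ext ω
    simp only [ouPath, expConv, mul_assoc, intervalIntegral.integral_const_mul]
    ring
  have hint : ∫ r in (0 : ℝ)..t, |1 + ∫ s in r..t, -1 * Real.exp (-(1 * (t - s)))| ^ α
      = (1 - Real.exp (-(α * t))) / α := by
    have h₁ : ∫ r in (0 : ℝ)..t, |1 + ∫ s in r..t, -1 * Real.exp (-(1 * (t - s)))| ^ α
        = ∫ r in (0 : ℝ)..t, 1 * Real.exp (-(α * (t - r))) := by
      refine intervalIntegral.integral_congr fun r _ => ?_
      rw [integral_exp_decay one_pos, show 1 + -1 / 1 * (1 - Real.exp (-(1 * ((t : ℝ) - r))))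
        = Real.exp (-(1 * ((t : ℝ) - r))) by ring, abs_of_pos (Real.exp_pos _), ← Real.exp_mul]
      ring_nf
    rw [h₁, integral_exp_decay hα, sub_zero, one_div_mul_eq_div]
  rw [hV, hk, hint]
  congr 3
  ring

variable {Z : ℝ → ℝ≥0 → Ω → ℝ}

/-- The solution from y is exp(-t) y plus the solution from 0, whose law does not depend on y.
Averaging y over μ therefore yields a convolution. -/
lemma integral_transitionOp (hL : IsSymmetricStableProcess α κ L P) (hα : 0 < α)
    (hZ : ∀ y, ∀ᵐ ω ∂P, ∀ t, Z y t ω = ouPath 1 y (fun s => L s ω) t)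
    (μ : Measure ℝ) [IsProbabilityMeasure μ] (t : ℝ≥0) {φ : ℝ → ℝ} (hφ : Measurable φ)
    (hb : ∃ C, ∀ y, |φ y| ≤ C) :
    ∫ y, transitionOp Z P t φ y ∂μ = ∫ y, φ y ∂((μ.map fun y => Real.exp (-t) * y) ∗
      (P.map fun ω => ouPath 1 0 (fun s => L s ω) t)) := by
  obtain ⟨C, hC⟩ := hb
  have hVm : AEMeasurable (fun ω => ouPath 1 0 (fun s => L s ω) t) P := by
    simpa using hL.aemeasurable_ouPath hα 1 0 1 t
  have := Measure.isProbabilityMeasure_map (μ := P) hVm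
  have := Measure.isProbabilityMeasure_map (μ := μ) (f := fun y => Real.exp (-t) * y) (by fun_prop)
  rw [integral_conv ((integrable_const C).mono' hφ.aestronglyMeasurable
    (Eventually.of_forall hC))]
  rw [integral_map (by fun_prop)]
  · refine integral_congr_ae (Eventually.of_forall fun y => ?_)
    simp only [transitionOp]
    rw [integral_map (f := fun u => φ (Real.exp (-t) * y + u)) hVm
      (hφ.comp (measurable_const_add _)).aestronglyMeasurable]
    refine integral_congr_ae ((hZ y).mono fun ω hω => ?_)
    simp only [hω t, ouPath]
    congr 1
    ring_nf
  · have : StronglyMeasurable fun q : ℝ × ℝ => φ (q.1 + q.2) :=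
      (hφ.comp measurable_add).stronglyMeasurable
    exact this.integral_prod_right.aestronglyMeasurable

/-- The invariant probability laws of the frozen equation are exactly the symmetric stable laws
with exponent `κ / α |h| ^ α`. -/
lemma isInvariantLaw_iff (hL : IsSymmetricStableProcess α κ L P) (hα : 0 < α)
    (hZ : ∀ y, ∀ᵐ ω ∂P, ∀ t, Z y t ω = ouPath 1 y (fun s => L s ω) t)
    (μ : Measure ℝ) :
    IsInvariantLaw Z P μ ↔ IsProbabilityMeasure μ ∧
      ∀ h, charFun μ h = (Real.exp (-(κ / α * |h| ^ α)) : ℂ) := by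
  refine and_congr_right fun hμ => ?_
  have hVm (t : ℝ≥0) : AEMeasurable (fun ω => ouPath 1 0 (fun s => L s ω) t) P := by
    simpa using hL.aemeasurable_ouPath hα 1 0 1 t
  have hVp (t : ℝ≥0) := Measure.isProbabilityMeasure_map (μ := P) (hVm t)
  have hμp (t : ℝ≥0) := Measure.isProbabilityMeasure_map (μ := μ)
    (f := fun y => Real.exp (-t) * y) (by fun_prop)
  set N : ℝ≥0 → Measure ℝ := fun t => (μ.map fun y => Real.exp (-t) * y) ∗
      (P.map fun ω => ouPath 1 0 (fun s => L s ω) t) with hN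
  have hNp (t : ℝ≥0) : IsProbabilityMeasure (N t) := by rw [hN]; infer_instance
  have hchar (t : ℝ≥0) (h : ℝ) : charFun (N t) h = charFun μ (Real.exp (-t) * h)
      * (Real.exp (-(κ / α * |h| ^ α * (1 - Real.exp (-(α * t))))) : ℂ) := by
    simp only [hN]
    rw [charFun_conv, charFun_map_mul, hL.charFun_ouPath hα]
  constructor
  · intro hinv h
    -- Invariance tested on indicators.
    have hNμ (t : ℝ≥0) : N t = μ := by
      refine Measure.ext fun A hA => ?_
      have hb : ∃ C, ∀ y : ℝ, |A.indicator (fun _ => (1 : ℝ)) y| ≤ C :=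
        ⟨1, fun y => by by_cases hy : y ∈ A <;> simp [hy]⟩
      have hm : Measurable (A.indicator fun _ : ℝ => (1 : ℝ)) := measurable_const.indicator hA
      have h₁ := hinv t _ hm hb
      rw [integral_transitionOp hL hα hZ μ t hm hb, integral_indicator_const _ hA,
        integral_indicator_const _ hA, smul_eq_mul, smul_eq_mul, mul_one, mul_one] at h₁
      exact (measureReal_eq_measureReal_iff).1 h₁
    -- Let t = n → ∞ in φ(h) = φ(exp(-t) h) · (noise factor), where φ is the characteristic function
    -- of μ: the first factor tends to φ(0) = 1, so only the limit of the noise factor remains.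
    have hexp (c : ℝ) (hc : 0 < c) :
        Tendsto (fun n : ℕ => Real.exp (-(c * (n : ℝ)))) atTop (𝓝 0) :=
      Real.tendsto_exp_neg_atTop_nhds_zero.comp
        (tendsto_natCast_atTop_atTop.const_mul_atTop hc)
    have h₁ : Tendsto (fun n : ℕ => charFun μ (Real.exp (-(1 * (n : ℝ))) * h)) atTop (𝓝 1) := by
      have := ((continuous_charFun (μ := μ)).tendsto (0 * h)).comp
        ((hexp 1 one_pos).mul_const h)
      simpa [charFun_zero, Function.comp_def] using this
    have h₂ := (((hexp α hα).const_sub 1).const_mul (κ / α * |h| ^ α)).neg.rexp.ofReal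
    rw [sub_zero, mul_one] at h₂
    have h₃ := h₁.mul h₂
    rw [one_mul] at h₃
    refine tendsto_nhds_unique (tendsto_const_nhds.congr fun n => ?_) h₃
    have := hchar n h
    rw [hNμ] at this
    simpa using this
  · intro hμchar t φ hφ hb
    rw [integral_transitionOp hL hα hZ μ t hφ hb]
    change ∫ y, φ y ∂(N t) = _
    have hNμ : N t = μ := by
      refine Measure.ext_of_charFun (funext fun h => ?_)
      rw [hchar, hμchar, hμchar, ← Complex.ofReal_mul, ← Real.exp_add]
      congr 2
      rw [abs_mul, abs_of_pos (Real.exp_pos _), Real.mul_rpow (Real.exp_pos _).le (abs_nonneg _),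
        ← Real.exp_mul]
      ring_nf
    rw [hNμ]

/-- The increment of L over [0, 1/α] already has this law, so no separate construction is needed. -/
lemma exists_stable_law (hL : IsSymmetricStableProcess α κ L P) (hα : 0 < α) :
    ∃ μ : Measure ℝ, IsProbabilityMeasure μ ∧
      ∀ h, charFun μ h = (Real.exp (-(κ / α * |h| ^ α)) : ℂ) := by
  have hm : AEMeasurable (fun ω => L (1 / α).toNNReal ω - L 0 ω) P :=
    (hL.aemeasurable _).sub (hL.aemeasurable _)
  refine ⟨P.map fun ω => L (1 / α).toNNReal ω - L 0 ω,
    Measure.isProbabilityMeasure_map hm, fun h => ?_⟩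
  rw [hL.charFun_increment _ _ zero_le, Real.coe_toNNReal _ (by positivity)]
  congr 3
  simp
  ring

end

/-! ### Well-posedness, averaging and the exact strong order -/

theorem mainTheorem3 {Ω : Type*} [MeasurableSpace Ω] (P : Measure Ω) [IsProbabilityMeasure P]
    (α κ₁ κ₂ : ℝ) (hα₁ : 1 < α) (hα₂ : α < 2) (hκ₁ : 0 < κ₁) (hκ₂ : 0 < κ₂)
    (L₁ L₂ : ℝ≥0 → Ω → ℝ)
    (hL₁ : IsSymmetricStableProcess α κ₁ L₁ P) (hL₂ : IsSymmetricStableProcess α κ₂ L₂ P)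
    (hind : IndepFun (fun ω t => L₁ t ω) (fun ω t => L₂ t ω) P) (x : ℝ) :
    -- the slow-fast system is well posed
    (∀ ε : ℝ, 0 < ε →
      (∃ X Y, IsSlowFastSolution slowDrift fastDrift α ε L₁ L₂ x 0 X Y P) ∧
      ∀ X Y X' Y', IsSlowFastSolution slowDrift fastDrift α ε L₁ L₂ x 0 X Y P →
        IsSlowFastSolution slowDrift fastDrift α ε L₁ L₂ x 0 X' Y' P →
        ∀ᵐ ω ∂P, ∀ t, X t ω = X' t ω ∧ Y t ω = Y' t ω) ∧
    -- the frozen equation is well posed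
    (∀ x' y : ℝ,
      (∃ Y, IsSDESolution (fastDrift x') L₂ y Y P) ∧
      ∀ Y Y', IsSDESolution (fastDrift x') L₂ y Y P → IsSDESolution (fastDrift x') L₂ y Y' P →
        ∀ᵐ ω ∂P, ∀ t, Y t ω = Y' t ω) ∧
    ∀ Yfr : ℝ → ℝ → ℝ≥0 → Ω → ℝ, IsFrozenFamily fastDrift L₂ Yfr P →
      -- its unique invariant probability measure has mean zero
      (∀ x' : ℝ, ∃! μ : Measure ℝ, IsInvariantLaw (Yfr x') P μ) ∧
      ∀ μ : ℝ → Measure ℝ, (∀ x', IsInvariantLaw (Yfr x') P (μ x')) →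
        (∀ x', Integrable (fun y => y) (μ x') ∧ ∫ y, y ∂(μ x') = 0) ∧
        -- the averaged equation is solved by `x + L₁` and by nothing else
        IsSDESolution (averagedDrift slowDrift μ) L₁ x (fun t ω => x + L₁ t ω) P ∧
        ∀ Xbar : ℝ≥0 → Ω → ℝ, IsSDESolution (averagedDrift slowDrift μ) L₁ x Xbar P →
          (∀ᵐ ω ∂P, ∀ t, Xbar t ω = x + L₁ t ω) ∧
          ∀ X Y : ℝ → ℝ≥0 → Ω → ℝ,
            (∀ ε : ℝ, 0 < ε →
              IsSlowFastSolution slowDrift fastDrift α ε L₁ L₂ x 0 (X ε) (Y ε) P) →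
            ∀ p : ℝ, 0 < p → p < α →
              0 < stableMoment α p ∧
              -- the exact strong error
              (∀ ε : ℝ, 0 < ε → ∀ t : ℝ≥0,
                Integrable (fun ω => |X ε t ω - Xbar t ω| ^ p) P ∧
                ∫ ω, |X ε t ω - Xbar t ω| ^ p ∂P
                  = stableMoment α p * κ₂ ^ (p / α)
                    * (∫ r in (0 : ℝ)..t, (1 - Real.exp (-(r / ε))) ^ α) ^ (p / α)
                    * ε ^ (p * (1 - 1 / α))) ∧
              -- its asymptotics as `ε → 0`
              (∀ t : ℝ≥0, 0 < t →
                Tendsto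
                  (fun ε : ℝ => (∫ ω, |X ε t ω - Xbar t ω| ^ p ∂P) / ε ^ (p * (1 - 1 / α)))
                  (𝓝[>] 0) (𝓝 (stableMoment α p * κ₂ ^ (p / α) * (t : ℝ) ^ (p / α)))) ∧
              -- no order larger than `1 - 1 / α` is possible, at a fixed time
              (∀ t : ℝ≥0, 0 < t → ∀ q : ℝ, 1 - 1 / α < q →
                ¬ ∃ C : ℝ, ∀ᶠ ε in 𝓝[>] (0 : ℝ),
                  ∫ ω, |X ε t ω - Xbar t ω| ^ p ∂P ≤ C * ε ^ (p * q)) ∧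
              -- nor for the supremum over a time interval
              (∀ T : ℝ≥0, 0 < T → ∀ q : ℝ, 1 - 1 / α < q →
                ¬ ∃ C : ℝ, ∀ᶠ ε in 𝓝[>] (0 : ℝ),
                  ∫⁻ ω, (⨆ t ∈ Icc (0 : ℝ≥0) T, ENNReal.ofReal (|X ε t ω - Xbar t ω| ^ p)) ∂P
                    ≤ ENNReal.ofReal (C * ε ^ (p * q))) := by
  have hα : 0 < α := by linarith
  refine ⟨fun ε _ => ⟨exists_isSlowFastSolution hα hL₁ hL₂ ε x, ?_⟩,
    fun x' y => ⟨exists_isSDESolution_fastDrift hα hL₂ x' y, ?_⟩, ?_⟩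
  · intro X Y X' Y' h h'
    filter_upwards [h.slow_eq_expConv hL₂, h'.slow_eq_expConv hL₂, h.fast_eq_ouPath hL₂,
      h'.fast_eq_ouPath hL₂] with ω h₁ h₂ h₃ h₄ t
    exact ⟨(h₁ t).trans (h₂ t).symm, (h₃ t).trans (h₄ t).symm⟩
  · intro Y Y' h h'
    filter_upwards [h.eq_ouPath hL₂, h'.eq_ouPath hL₂] with ω h₁ h₂ t
    exact (h₁ t).trans (h₂ t).symm
  intro Yfr hYfr
  have hinv (x' : ℝ) (μ : Measure ℝ) := isInvariantLaw_iff hL₂ hα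
    (fun y => (hYfr x' y).eq_ouPath hL₂) μ
  refine ⟨fun x' => ?_, fun μ hμ => ?_⟩
  · obtain ⟨μ, hμp, hμ⟩ := exists_stable_law hL₂ hα
    refine ⟨μ, (hinv x' μ).2 ⟨hμp, hμ⟩, fun ν hν => ?_⟩
    obtain ⟨hνp, hν⟩ := (hinv x' ν).1 hν
    exact Measure.ext_of_charFun (funext fun h => by rw [hν, hμ])
  have hmean (x' : ℝ) : Integrable (fun y => y) (μ x') ∧ ∫ y, y ∂(μ x') = 0 := by
    obtain ⟨hμp, hμ⟩ := (hinv x' (μ x')).1 (hμ x')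
    -- The first moment is the case p = 1 of the moment formula; this is where α > 1 enters.
    have h := (stable_moment hα₂ (by positivity) hμ one_pos hα₁).1
    simp only [Real.rpow_one] at h
    refine ⟨(integrable_norm_iff (by fun_prop)).1 h, integral_eq_zero_of_charFun_even fun h => ?_⟩
    rw [hμ, hμ, abs_neg]
  have hdrift : averagedDrift slowDrift μ = fun _ => 0 := funext fun x' => (hmean x').2
  refine ⟨hmean, ?_, fun Xbar hXbar => ?_⟩
  · refine ⟨fun t => (hL₁.aemeasurable t).const_add x, ?_, ?_⟩
    · filter_upwards [hL₁.cadlag] with ω h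
      exact (IsCadlag.of_continuous continuous_const).add h
    · rw [hdrift]
      exact Eventually.of_forall fun ω t => by simp
  -- With zero drift the integral equation is already an explicit formula, so uniqueness is
  -- immediate.
  have hXbar' : ∀ᵐ ω ∂P, ∀ t, Xbar t ω = x + L₁ t ω := by
    filter_upwards [hXbar.eq] with ω h t
    simpa [hdrift] using (h t).2
  refine ⟨hXbar', fun X Y hXY p hp hpα => ?_⟩
  have hM := stableMoment_pos hα₂ hp hpα
  have herr (ε : ℝ) (hε : 0 < ε) (t : ℝ≥0) : (fun ω => |X ε t ω - Xbar t ω| ^ p) =ᵐ[P]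
      fun ω => |expConv (1 / ε) (fun s => 1 / ε ^ (1 / α) * L₂ s ω) t| ^ p := by
    filter_upwards [(hXY ε hε).slow_eq_expConv hL₂, hXbar'] with ω h₁ h₂
    rw [h₁, h₂]
    congr 2
    ring
  have hexact (ε : ℝ) (hε : 0 < ε) (t : ℝ≥0) :
      Integrable (fun ω => |X ε t ω - Xbar t ω| ^ p) P ∧
      ∫ ω, |X ε t ω - Xbar t ω| ^ p ∂P = stableMoment α p * κ₂ ^ (p / α)
        * (∫ r in (0 : ℝ)..t, (1 - Real.exp (-(r / ε))) ^ α) ^ (p / α)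
        * ε ^ (p * (1 - 1 / α)) := by
    obtain ⟨h₁, h₂⟩ := hL₂.moment_expConv hα₂ hκ₂ hε t hp hpα
    exact ⟨h₁.congr (herr ε hε t).symm, (integral_congr_ae (herr ε hε t)).trans h₂⟩
  have hlim (t : ℝ≥0) : Tendsto
      (fun ε : ℝ => (∫ ω, |X ε t ω - Xbar t ω| ^ p ∂P) / ε ^ (p * (1 - 1 / α)))
      (𝓝[>] 0) (𝓝 (stableMoment α p * κ₂ ^ (p / α) * (t : ℝ) ^ (p / α))) := by
    refine (((tendsto_integral_one_sub_exp hα t).rpow_const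
      (Or.inr (div_nonneg hp.le hα.le))).const_mul _).congr' ?_
    filter_upwards [self_mem_nhdsWithin] with ε hε
    have hε' : (0 : ℝ) < ε := hε
    rw [(hexact ε hε t).2, mul_div_cancel_right₀ _ (Real.rpow_pos_of_pos hε' _).ne']
  have horder (t : ℝ≥0) (ht : 0 < t) (q : ℝ) (hq : 1 - 1 / α < q) :
      ¬ ∃ C : ℝ, ∀ᶠ ε in 𝓝[>] (0 : ℝ),
        ∫ ω, |X ε t ω - Xbar t ω| ^ p ∂P ≤ C * ε ^ (p * q) :=
    not_le_mul_rpow_of_tendsto (by positivity) (mul_lt_mul_of_pos_left hq hp) (hlim t)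
  refine ⟨hM, hexact, fun t _ => hlim t, horder, fun T hT q hq => ?_⟩
  rintro ⟨C, hC⟩
  -- `ENNReal.ofReal` truncates negative numbers to 0, so a nonnegative constant is needed to return
  -- to a real inequality.
  refine horder T hT q hq ⟨|C|, ?_⟩
  filter_upwards [hC, self_mem_nhdsWithin] with ε hε hpos
  have hpos' : (0 : ℝ) < ε := hpos
  have hpow := (Real.rpow_pos_of_pos hpos' (p * q)).le
  rw [← ENNReal.ofReal_le_ofReal_iff (mul_nonneg (abs_nonneg C) hpow),
    ofReal_integral_eq_lintegral_ofReal (hexact ε hpos T).1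
      (Eventually.of_forall fun ω => Real.rpow_nonneg (abs_nonneg _) p)]
  refine (lintegral_mono fun ω => ?_).trans (hε.trans
    (ENNReal.ofReal_le_ofReal (mul_le_mul_of_nonneg_right (le_abs_self C) hpow)))
  exact le_iSup₂ (f := fun (t : ℝ≥0) (_ : t ∈ Icc 0 T) =>
    ENNReal.ofReal (|X ε t ω - Xbar t ω| ^ p)) T ⟨zero_le, le_rfl⟩
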